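/- Theorem. In the real-RAM model (exact real arithmetic $+,-,\cdot,/$ and comparisons, integer arithmetic on words of $O(\log(n+m+2))$ bits, indirect addressing, unit cost per elementary operation, no rounding of reals to integers), the following problem can be solved by an algorithm. Input: $n\ge 0$ points in the plane and $m\ge 0$ closed half-planes $\{(x,y) : ax+by\le c\}$, $(a,b)\neq(0,0)$ (lower, upper or with vertical boundary), each with a positive real weight, such that the union of all the half-planes contains all the points. Output: a subset of the half-planes that covers all the points and has minimum total weight among all such subsets. There is an algorithm that solves every instance in time $O(n^3 m\log(m+n)+1)$, and there is an algorithm that solves every instance in time $O(n^3\log n+n^2m^2\log m+1)$; the implied constants are absolute, and an expression such as $n^3\log n$ is read as $0$ for $n=0$. -/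

import Mathlib

/-! ## A real RAM

Running times are measured on a real RAM.  It has integer variables, arrays of
integers, and arrays of exact real numbers, each of them named by a natural number (a program
mentions finitely many names; every cell that holds no input initially holds `0`).
Integers are words (see `Exec`), indices of array cells are computed integers, and
reals admit only `+`, `-`, `*`, `/` and comparison: there is no rounding and no conversion of
reals to integers.  Every elementary operation takes one unit of time. -/

namespace RealRAM

/-- The contents of the memory. -/
structure Mem where
  /-- integer variables -/
  var : ℕ → ℕ
  /-- integer arrays: `arr a i` is the cell `i` of the array `a` -/
  arr : ℕ → ℕ → ℕ
  /-- real arrays: `real a i` is the cell `i` of the array `a` -/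
  real : ℕ → ℕ → ℝ

/-- Integer expressions. -/
inductive NatExpr where
  | const (c : ℕ)
  | var (x : ℕ)
  | get (a : ℕ) (i : NatExpr)
  | add (e f : NatExpr)
  | sub (e f : NatExpr)
  | mul (e f : NatExpr)
  | div (e f : NatExpr)

namespace NatExpr

/-- The value of an integer expression (subtraction is truncated at `0`, division rounds
down). -/
def eval (s : Mem) : NatExpr → ℕ
  | const c => c
  | var x => s.var x
  | get a i => s.arr a (i.eval s)
  | add e f => e.eval s + f.eval s
  | sub e f => e.eval s - f.eval s
  | mul e f => e.eval s * f.eval s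
  | div e f => e.eval s / f.eval s

/-- The time to evaluate an integer expression: one unit for each node. -/
def cost : NatExpr → ℕ
  | const _ => 1
  | var _ => 1
  | get _ i => i.cost + 1
  | add e f => e.cost + f.cost + 1
  | sub e f => e.cost + f.cost + 1
  | mul e f => e.cost + f.cost + 1
  | div e f => e.cost + f.cost + 1

end NatExpr

/-- Real expressions; the only constants are rational. -/
inductive RealExpr where
  | const (q : ℚ)
  | get (a : ℕ) (i : NatExpr)
  | add (e f : RealExpr)
  | sub (e f : RealExpr)
  | mul (e f : RealExpr)
  | div (e f : RealExpr)

namespace RealExpr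

/-- The value of a real expression. -/
noncomputable def eval (s : Mem) : RealExpr → ℝ
  | const q => (q : ℝ)
  | get a i => s.real a (i.eval s)
  | add e f => e.eval s + f.eval s
  | sub e f => e.eval s - f.eval s
  | mul e f => e.eval s * f.eval s
  | div e f => e.eval s / f.eval s

/-- The time to evaluate a real expression: one unit for each node. -/
def cost : RealExpr → ℕ
  | const _ => 1
  | get _ i => i.cost + 1
  | add e f => e.cost + f.cost + 1
  | sub e f => e.cost + f.cost + 1
  | mul e f => e.cost + f.cost + 1
  | div e f => e.cost + f.cost + 1

end RealExpr

/-- Boolean tests. -/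
inductive Test where
  | natLe (e f : NatExpr)
  | natEq (e f : NatExpr)
  | realLe (e f : RealExpr)
  | realEq (e f : RealExpr)
  | neg (b : Test)
  | conj (b c : Test)
  | disj (b c : Test)

namespace Test

/-- The truth value of a test. -/
def Holds (s : Mem) : Test → Prop
  | natLe e f => e.eval s ≤ f.eval s
  | natEq e f => e.eval s = f.eval s
  | realLe e f => e.eval s ≤ f.eval s
  | realEq e f => e.eval s = f.eval s
  | neg b => ¬ b.Holds s
  | conj b c => b.Holds s ∧ c.Holds s
  | disj b c => b.Holds s ∨ c.Holds s

/-- The time to evaluate a test: one unit for each node. -/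
def cost : Test → ℕ
  | natLe e f => e.cost + f.cost + 1
  | natEq e f => e.cost + f.cost + 1
  | realLe e f => e.cost + f.cost + 1
  | realEq e f => e.cost + f.cost + 1
  | neg b => b.cost + 1
  | conj b c => b.cost + c.cost + 1
  | disj b c => b.cost + c.cost + 1

end Test

/-- Programs. -/
inductive Program where
  /-- do nothing -/
  | skip
  /-- variable `x` := `e` -/
  | assign (x : ℕ) (e : NatExpr)
  /-- cell `i` of the integer array `a` := `e` -/
  | storeNat (a : ℕ) (i e : NatExpr)
  /-- cell `i` of the real array `a` := `e` -/
  | storeReal (a : ℕ) (i : NatExpr) (e : RealExpr)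
  /-- first `A`, then `B` -/
  | seq (A B : Program)
  /-- if `b` then `A` else `B` -/
  | ite (b : Test) (A B : Program)
  /-- while `b` do `A` -/
  | loop (b : Test) (A : Program)

/-- `Exec W A s t s'`: on a machine whose words hold the integers `0, …, W`, the program `A`
started with the memory `s` halts after `t` units of time with the memory `s'`.
An integer that exceeds `W` or is to be an array index that exceeds `W` in a write
cannot be stored: in such a case the program has no execution. -/
inductive Exec (W : ℕ) : Program → Mem → ℕ → Mem → Prop where
  | skip (s : Mem) : Exec W .skip s 1 s
  | assign (s : Mem) (x : ℕ) (e : NatExpr) (he : e.eval s ≤ W) :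
      Exec W (.assign x e) s (e.cost + 1)
        { s with var := Function.update s.var x (e.eval s) }
  | storeNat (s : Mem) (a : ℕ) (i e : NatExpr) (hi : i.eval s ≤ W) (he : e.eval s ≤ W) :
      Exec W (.storeNat a i e) s (i.cost + e.cost + 1)
        { s with
          arr := Function.update s.arr a (Function.update (s.arr a) (i.eval s) (e.eval s)) }
  | storeReal (s : Mem) (a : ℕ) (i : NatExpr) (e : RealExpr) (hi : i.eval s ≤ W) :
      Exec W (.storeReal a i e) s (i.cost + e.cost + 1)
        { s with
          real := Function.update s.real a (Function.update (s.real a) (i.eval s) (e.eval s)) }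
  | seq {A B : Program} {s s' s'' : Mem} {t u : ℕ}
      (hA : Exec W A s t s') (hB : Exec W B s' u s'') :
      Exec W (.seq A B) s (t + u) s''
  | ite_true {b : Test} {A B : Program} {s s' : Mem} {t : ℕ}
      (hb : b.Holds s) (hA : Exec W A s t s') :
      Exec W (.ite b A B) s (b.cost + t + 1) s'
  | ite_false {b : Test} {A B : Program} {s s' : Mem} {t : ℕ}
      (hb : ¬ b.Holds s) (hB : Exec W B s t s') :
      Exec W (.ite b A B) s (b.cost + t + 1) s'
  | loop_true {b : Test} {A : Program} {s s' s'' : Mem} {t u : ℕ}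
      (hb : b.Holds s) (hA : Exec W A s t s') (hL : Exec W (.loop b A) s' u s'') :
      Exec W (.loop b A) s (b.cost + t + u + 1) s''
  | loop_false {b : Test} {A : Program} {s : Mem} (hb : ¬ b.Holds s) :
      Exec W (.loop b A) s (b.cost + 1) s

end RealRAM

/-! ## Half-plane coverage -/

namespace HalfPlaneCoverage

open RealRAM

/-- A closed half-plane `{(x, y) | a x + b y ≤ c}` with a positive weight.  It is a lower one
if `0 < b` and an upper one if `b < 0`; vertical boundary lines (`b = 0`) are allowed too. -/
structure WeightedHalfPlane where
  a : ℝ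
  b : ℝ
  c : ℝ
  weight : ℝ
  nondegenerate : a ≠ 0 ∨ b ≠ 0
  weight_pos : 0 < weight

/-- The half-plane as a set of points. -/
def WeightedHalfPlane.region (h : WeightedHalfPlane) : Set (ℝ × ℝ) :=
  {p | h.a * p.1 + h.b * p.2 ≤ h.c}

/-- The half-planes with index in `T` cover all the points. -/
def Covers {n m : ℕ} (P : Fin n → ℝ × ℝ) (S : Fin m → WeightedHalfPlane)
    (T : Finset (Fin m)) : Prop :=
  ∀ j, ∃ i ∈ T, P j ∈ (S i).region

/-- The total weight of the half-planes with index in `T`. -/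
noncomputable def totalWeight {m : ℕ} (S : Fin m → WeightedHalfPlane) (T : Finset (Fin m)) : ℝ :=
  ∑ i ∈ T, (S i).weight

/-- The half-planes with index in `T` form a minimum-weight coverage of the points. -/
def IsMinWeightCoverage {n m : ℕ} (P : Fin n → ℝ × ℝ) (S : Fin m → WeightedHalfPlane)
    (T : Finset (Fin m)) : Prop :=
  Covers P S T ∧ ∀ T' : Finset (Fin m), Covers P S T' → totalWeight S T ≤ totalWeight S T'

/-- The memory that holds the input: `n` and `m` in the integer variables `0` and `1`,
the coordinates of the points in the real arrays `0` and `1`, the coefficients of the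
half-planes in the real arrays `2`, `3`, `4` and their weights in the real array `5`. -/
noncomputable def inputMem {n m : ℕ} (P : Fin n → ℝ × ℝ) (S : Fin m → WeightedHalfPlane) :
    Mem where
  var
    | 0 => n
    | 1 => m
    | _ => 0
  arr _ _ := 0
  real
    | 0, i => if hi : i < n then (P ⟨i, hi⟩).1 else 0
    | 1, i => if hi : i < n then (P ⟨i, hi⟩).2 else 0
    | 2, i => if hi : i < m then (S ⟨i, hi⟩).a else 0
    | 3, i => if hi : i < m then (S ⟨i, hi⟩).b else 0
    | 4, i => if hi : i < m then (S ⟨i, hi⟩).c else 0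
    | 5, i => if hi : i < m then (S ⟨i, hi⟩).weight else 0
    | _, _ => 0

/-- The subset that is output: the integer array `0` holds its indicator vector. -/
def outputSet (m : ℕ) (s : Mem) : Finset (Fin m) :=
  Finset.univ.filter fun i => s.arr 0 i = 1

/-- One program computes a minimum-weight coverage in time `O(f n m)` for all `n` points and `m`
weighted half-planes whose union covers the points.  The words of the machine have
`O(log (n + m + 2))` bits. -/
def SolvableInTime (f : ℕ → ℕ → ℝ) : Prop :=
  ∃ (A : Program) (k : ℕ) (C : ℝ), ∀ (n m : ℕ) (P : Fin n → ℝ × ℝ)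
    (S : Fin m → WeightedHalfPlane), Covers P S Finset.univ →
    ∃ (t : ℕ) (s : Mem), Exec ((n + m + 2) ^ k) A (inputMem P S) t s ∧
      (t : ℝ) ≤ C * f n m ∧ IsMinWeightCoverage P S (outputSet m s)

end HalfPlaneCoverage

/-! ## Verification of real RAM programs -/

/-! Take a coverage, shrink it to an inclusion-minimal one, `T'`, and pick any `h` in `T'`. Among
the points that `h` alone covers, let `p` be one farthest out in the direction of the normal `(a h,
b h)`. Points strictly beyond `p` in that direction are covered by the other members of `T'`, all of
which miss `p`; every remaining point lies in `h`. Project from `p`: a point with component σ > 0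
along the normal and τ along the boundary goes to (τ/σ, 1/σ). A half-plane that misses `p` becomes
the region on or under a non-vertical line, and τ/σ grows with the angle around `p`. So the points
beyond `p` lie under an upper envelope of lines, and in angular order they split into intervals, one
line per interval and no line used twice (`exists_chain_of_lines`). List the points by angle around
`p`, starting at the boundary direction of `h`, with `p` last: the points beyond `p` come first, and
`h` takes all the rest as one final interval. This is a chain no heavier than the coverage
(`exists_cheapChain`).

Conversely, the half-planes of any chain cover all the points and weigh at most as much as the
chain. Hence the optimum is the least weight of a chain over all centres `p` and all relevant
rotations of the angular order. Dynamic programming finds the cheapest chain of one rotation in time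
O(nm): intervals may be extended to the left as far as possible because prefix costs are monotone
(`ChainTable.le_of_chain`), and the left ends are maintained in constant time per table entry.

Trying all rotations (at most `n` per centre) costs O(n³m); trying only those given by the `m`
half-planes costs O(n²m²). Sorting by counting ranks adds O(n³). Both totals are below the claimed
bounds, and the additive constant matters only where a logarithm vanishes. -/

namespace RealRAM

/-! ### Memory updates. -/

namespace Mem

/-- The memory with the variable `x` set to `v`. -/
def setVar (s : Mem) (x v : ℕ) : Mem := { s with var := Function.update s.var x v }

/-- The memory with the cell `i` of the integer array `a` set to `v`. -/
def setArr (s : Mem) (a i v : ℕ) : Mem :=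
  { s with arr := Function.update s.arr a (Function.update (s.arr a) i v) }

/-- The memory with the cell `i` of the real array `a` set to `v`. -/
noncomputable def setReal (s : Mem) (a i : ℕ) (v : ℝ) : Mem :=
  { s with real := Function.update s.real a (Function.update (s.real a) i v) }

@[simp] theorem setVar_var (s : Mem) (x v y : ℕ) :
    (s.setVar x v).var y = if y = x then v else s.var y := by
  simp [setVar, Function.update_apply]

@[simp] theorem setVar_arr (s : Mem) (x v : ℕ) : (s.setVar x v).arr = s.arr := rfl

@[simp] theorem setVar_real (s : Mem) (x v : ℕ) : (s.setVar x v).real = s.real := rfl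

@[simp] theorem setArr_var (s : Mem) (a i v : ℕ) : (s.setArr a i v).var = s.var := rfl

@[simp] theorem setArr_real (s : Mem) (a i v : ℕ) : (s.setArr a i v).real = s.real := rfl

@[simp] theorem setArr_arr (s : Mem) (a i v b : ℕ) :
    (s.setArr a i v).arr b = if b = a then Function.update (s.arr a) i v else s.arr b := by
  simp [setArr, Function.update_apply]

@[simp] theorem setReal_var (s : Mem) (a i : ℕ) (v : ℝ) : (s.setReal a i v).var = s.var := rfl

@[simp] theorem setReal_arr (s : Mem) (a i : ℕ) (v : ℝ) : (s.setReal a i v).arr = s.arr := rfl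

@[simp] theorem setReal_real (s : Mem) (a i : ℕ) (v : ℝ) (b : ℕ) :
    (s.setReal a i v).real b = if b = a then Function.update (s.real a) i v else s.real b := by
  simp [setReal, Function.update_apply]

end Mem

attribute [simp] NatExpr.eval RealExpr.eval Test.Holds

/-! ### Frame conditions. -/

namespace Program

/-- Whether a program assigns to the variable `x`. -/
def writesVar (x : ℕ) : Program → Bool
  | skip => false
  | assign y _ => x == y
  | storeNat _ _ _ => false
  | storeReal _ _ _ => false
  | seq A B => A.writesVar x || B.writesVar x
  | ite _ A B => A.writesVar x || B.writesVar x
  | loop _ A => A.writesVar x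

/-- Whether a program writes to the integer array `a`. -/
def writesArr (a : ℕ) : Program → Bool
  | skip => false
  | assign _ _ => false
  | storeNat b _ _ => a == b
  | storeReal _ _ _ => false
  | seq A B => A.writesArr a || B.writesArr a
  | ite _ A B => A.writesArr a || B.writesArr a
  | loop _ A => A.writesArr a

/-- Whether a program writes to the real array `a`. -/
def writesReal (a : ℕ) : Program → Bool
  | skip => false
  | assign _ _ => false
  | storeNat _ _ _ => false
  | storeReal b _ _ => a == b
  | seq A B => A.writesReal a || B.writesReal a
  | ite _ A B => A.writesReal a || B.writesReal a
  | loop _ A => A.writesReal a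

end Program

/-- The memories `s` and `s'` agree on everything that the program `A` does not write to. -/
structure Same (A : Program) (s s' : Mem) : Prop where
  var : ∀ x, A.writesVar x = false → s'.var x = s.var x
  arr : ∀ a, A.writesArr a = false → s'.arr a = s.arr a
  real : ∀ a, A.writesReal a = false → s'.real a = s.real a

namespace Same

theorem refl (A : Program) (s : Mem) : Same A s s :=
  ⟨fun _ _ => rfl, fun _ _ => rfl, fun _ _ => rfl⟩

theorem trans {A : Program} {s s' s'' : Mem} (h : Same A s s') (h' : Same A s' s'') :
    Same A s s'' :=
  ⟨fun x hx => (h'.var x hx).trans (h.var x hx), fun x hx => (h'.arr x hx).trans (h.arr x hx),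
    fun x hx => (h'.real x hx).trans (h.real x hx)⟩

theorem mono {A B : Program} {s s' : Mem} (h : Same A s s')
    (hv : ∀ x, B.writesVar x = false → A.writesVar x = false)
    (ha : ∀ x, B.writesArr x = false → A.writesArr x = false)
    (hr : ∀ x, B.writesReal x = false → A.writesReal x = false) : Same B s s' :=
  ⟨fun x hx => h.var x (hv x hx), fun x hx => h.arr x (ha x hx), fun x hx => h.real x (hr x hx)⟩

theorem seq_left {A B : Program} {s s' : Mem} (h : Same A s s') : Same (.seq A B) s s' := by
  refine h.mono ?_ ?_ ?_ <;>
    simp +contextual [Program.writesVar, Program.writesArr, Program.writesReal]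

theorem seq_right {A B : Program} {s s' : Mem} (h : Same B s s') : Same (.seq A B) s s' := by
  refine h.mono ?_ ?_ ?_ <;>
    simp +contextual [Program.writesVar, Program.writesArr, Program.writesReal]

theorem ite_left {b : Test} {A B : Program} {s s' : Mem} (h : Same A s s') :
    Same (.ite b A B) s s' := by
  refine h.mono ?_ ?_ ?_ <;>
    simp +contextual [Program.writesVar, Program.writesArr, Program.writesReal]

theorem ite_right {b : Test} {A B : Program} {s s' : Mem} (h : Same B s s') :
    Same (.ite b A B) s s' := by
  refine h.mono ?_ ?_ ?_ <;>
    simp +contextual [Program.writesVar, Program.writesArr, Program.writesReal]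

theorem loop {b : Test} {A : Program} {s s' : Mem} (h : Same A s s') : Same (.loop b A) s s' :=
  ⟨h.var, h.arr, h.real⟩

end Same

/-- The write predicates are syntactic and Boolean, so for a concrete program each frame fact
reduces to `decide`. -/
theorem Exec.same {W : ℕ} {A : Program} {s s' : Mem} {t : ℕ} (h : Exec W A s t s') :
    Same A s s' := by
  induction h with
  | skip s => exact Same.refl _ _
  | assign s x e he =>
    refine ⟨fun y hy => ?_, fun _ _ => rfl, fun _ _ => rfl⟩
    simp [Program.writesVar] at hy
    simp [hy]
  | storeNat s a i e hi he =>
    refine ⟨fun _ _ => rfl, fun y hy => ?_, fun _ _ => rfl⟩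
    simp [Program.writesArr] at hy
    simp [hy]
  | storeReal s a i e hi =>
    refine ⟨fun _ _ => rfl, fun _ _ => rfl, fun y hy => ?_⟩
    simp [Program.writesReal] at hy
    simp [hy]
  | seq _ _ hA hB => exact hA.seq_left.trans hB.seq_right
  | ite_true _ _ hA => exact hA.ite_left
  | ite_false _ _ hB => exact hB.ite_right
  | loop_true _ _ _ hA hL => exact hA.loop.trans hL
  | loop_false _ => exact Same.refl _ _

/-- Started with the memory `s`, the program `A` halts after at most `T` units of time with a
memory that satisfies `Q`. -/
def Runs (W : ℕ) (A : Program) (s : Mem) (T : ℕ) (Q : Mem → Prop) : Prop :=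
  ∃ t s', Exec W A s t s' ∧ t ≤ T ∧ Q s'

/-! ### Proof rules for total correctness with time bounds. -/

namespace Runs

variable {W : ℕ} {A B : Program} {s : Mem} {T U V : ℕ} {Q R : Mem → Prop}

/-- The frame relation is supplied to the new postcondition, so a specification needs to mention
only what changes. -/
theorem mono (h : Runs W A s T Q) (hT : T ≤ U) (hQ : ∀ s', Same A s s' → Q s' → R s') :
    Runs W A s U R := by
  obtain ⟨t, s', he, ht, hq⟩ := h
  exact ⟨t, s', he, ht.trans hT, hQ s' he.same hq⟩

theorem skip (hT : 1 ≤ T) (hQ : Q s) : Runs W .skip s T Q := ⟨1, s, .skip s, hT, hQ⟩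

theorem assign {x : ℕ} {e : NatExpr} (he : e.eval s ≤ W) (hT : e.cost + 1 ≤ T)
    (hQ : Q (s.setVar x (e.eval s))) : Runs W (.assign x e) s T Q :=
  ⟨_, _, .assign s x e he, hT, hQ⟩

theorem storeNat {a : ℕ} {i e : NatExpr} (hi : i.eval s ≤ W) (he : e.eval s ≤ W)
    (hT : i.cost + e.cost + 1 ≤ T) (hQ : Q (s.setArr a (i.eval s) (e.eval s))) :
    Runs W (.storeNat a i e) s T Q :=
  ⟨_, _, .storeNat s a i e hi he, hT, hQ⟩

theorem storeReal {a : ℕ} {i : NatExpr} {e : RealExpr} (hi : i.eval s ≤ W)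
    (hT : i.cost + e.cost + 1 ≤ T) (hQ : Q (s.setReal a (i.eval s) (e.eval s))) :
    Runs W (.storeReal a i e) s T Q :=
  ⟨_, _, .storeReal s a i e hi, hT, hQ⟩

theorem seq (U V : ℕ) (hT : U + V ≤ T)
    (h : Runs W A s U (fun s' => Runs W B s' V Q)) : Runs W (.seq A B) s T Q := by
  obtain ⟨t, s', he, ht, u, s'', he', hu, hq⟩ := h
  exact ⟨t + u, s'', .seq he he', by omega, hq⟩

/-- Sequential composition through an intermediate assertion. -/
theorem seq_mid (U V : ℕ) (hT : U + V ≤ T) (h : Runs W A s U R)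
    (h' : ∀ s', Same A s s' → R s' → Runs W B s' V Q) : Runs W (.seq A B) s T Q :=
  seq U V hT (h.mono le_rfl h')

theorem ite {b : Test} (U : ℕ) (hT : b.cost + U + 1 ≤ T) (hA : b.Holds s → Runs W A s U Q)
    (hB : ¬ b.Holds s → Runs W B s U Q) : Runs W (.ite b A B) s T Q := by
  by_cases hb : b.Holds s
  · obtain ⟨t, s', he, ht, hq⟩ := hA hb
    exact ⟨_, s', .ite_true hb he, by omega, hq⟩
  · obtain ⟨t, s', he, ht, hq⟩ := hB hb
    exact ⟨_, s', .ite_false hb he, by omega, hq⟩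

end Runs

/-- `for x := 0, 1, …, e - 1 do A` -/
def Program.forLoop (x : ℕ) (e : NatExpr) (A : Program) : Program :=
  .seq (.assign x (.const 0))
    (.loop (.neg (.natLe e (.var x))) (.seq A (.assign x (.add (.var x) (.const 1)))))

/-- The bound `e` is evaluated anew in every round, hence the hypothesis that its value stays `N`. A
round costs `e.cost + 3` for the test, `U + 4` for the body with its increment, and one unit for the
loop. -/
theorem Runs.loop_aux {W : ℕ} {A : Program} {x : ℕ} {e : NatExpr} {U N : ℕ}
    {I : ℕ → Mem → Prop} {s₀ : Mem} (hNW : N ≤ W)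
    (hN : ∀ i s, i ≤ N → I i s → s.var x = i → Same (.forLoop x e A) s₀ s → e.eval s = N)
    (hA : ∀ i s, i < N → I i s → s.var x = i → Same (.forLoop x e A) s₀ s →
      Runs W A s U (fun s' => s'.var x = i ∧ I (i + 1) (s'.setVar x (i + 1)))) (k : ℕ) :
    ∀ i s, i + k = N → I i s → s.var x = i → Same (.forLoop x e A) s₀ s →
      Runs W (.loop (.neg (.natLe e (.var x))) (.seq A (.assign x (.add (.var x) (.const 1))))) s
        (k * (e.cost + U + 8) + e.cost + 4)
        (fun s' => I N s' ∧ s'.var x = N) := by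
  induction k with
  | zero =>
    intro i s hi hI hx hs
    have he := hN i s (by omega) hI hx hs
    have hb : ¬ (Test.neg (.natLe e (.var x))).Holds s := by simp; omega
    obtain rfl : i = N := by omega
    exact ⟨_, s, .loop_false hb, by simp [Test.cost, NatExpr.cost], hI, hx⟩
  | succ k ih =>
    intro i s hi hI hx hs
    have he := hN i s (by omega) hI hx hs
    have hb : (Test.neg (.natLe e (.var x))).Holds s := by simp; omega
    have hbody : Runs W (.seq A (.assign x (.add (.var x) (.const 1)))) s (U + 4)
        (fun s' => I (i + 1) s' ∧ s'.var x = i + 1) := by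
      refine Runs.seq_mid U 4 le_rfl (hA i s (by omega) hI hx hs) ?_
      rintro s' - ⟨h1, h2⟩
      refine Runs.assign (by simp; omega) (by simp [NatExpr.cost]) ?_
      simpa [h1] using h2
    obtain ⟨t, s', he', ht, hI', hx'⟩ := hbody
    obtain ⟨u, s'', hl, hu, hq⟩ := ih (i + 1) s' (by omega) hI' hx'
      (hs.trans (he'.same.loop.seq_right))
    refine ⟨_, s'', .loop_true hb he' hl, ?_, hq⟩
    simp only [Test.cost, NatExpr.cost]
    have := Nat.succ_mul k (e.cost + U + 8)
    simp only [Nat.succ_eq_add_one] at this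
    omega

/-- The rule for loops with a counter: `I i` is the invariant before the round `i`. -/
theorem Runs.forLoop {W : ℕ} {A : Program} {x : ℕ} {e : NatExpr} {s : Mem} {T : ℕ}
    {Q : Mem → Prop} (N U : ℕ) (I : ℕ → Mem → Prop) (hNW : N ≤ W)
    (hT : N * (e.cost + U + 8) + e.cost + 6 ≤ T)
    (h0 : I 0 (s.setVar x 0))
    (hN : ∀ i s', i ≤ N → I i s' → s'.var x = i → Same (.forLoop x e A) s s' → e.eval s' = N)
    (hA : ∀ i s', i < N → I i s' → s'.var x = i → Same (.forLoop x e A) s s' →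
      Runs W A s' U (fun s'' => s''.var x = i ∧ I (i + 1) (s''.setVar x (i + 1))))
    (hQ : ∀ s', I N s' → s'.var x = N → Same (.forLoop x e A) s s' → Q s') :
    Runs W (.forLoop x e A) s T Q := by
  have h : Runs W (.forLoop x e A) s T (fun s' => I N s' ∧ s'.var x = N) := by
    refine Runs.seq_mid 2 (N * (e.cost + U + 8) + e.cost + 4) (by omega)
      (R := fun s' => s' = s.setVar x 0)
      (Runs.assign (by simp) (by simp [NatExpr.cost]) (by simp)) ?_
    rintro _ hs rfl
    exact Runs.loop_aux hNW hN hA N 0 _ (by omega) h0 (by simp) hs.seq_left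
  exact h.mono le_rfl fun s' hs h => hQ s' h.1 h.2 hs

end RealRAM

/-! ## Chains of intervals -/

namespace HalfPlaneCoverage

open RealRAM

/-- `Chain cov w j c`: the positions `0, …, j - 1` can be cut into intervals each of which
is covered by a single set, such that the weights of these sets add up to `c`. -/
inductive Chain (cov : ℕ → ℕ → Prop) (w : ℕ → ℝ) : ℕ → ℝ → Prop where
  | nil : Chain cov w 0 0
  | step {i j h : ℕ} {c : ℝ} (hc : Chain cov w i c) (hij : i < j)
      (hcov : ∀ l, i ≤ l → l < j → cov l h) : Chain cov w j (c + w h)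

theorem exists_threshold (p : ℕ → Prop) (L : ℕ) (hp : ∀ i j, i ≤ j → j < L → p j → p i) :
    ∃ g ≤ L, ∀ j < L, (p j ↔ j < g) := by
  induction L with
  | zero => exact ⟨0, le_rfl, by simp⟩
  | succ L ih =>
    obtain ⟨g, hg, h⟩ := ih fun i j hij hj => hp i j hij (by omega)
    by_cases hL : p L
    · exact ⟨L + 1, le_rfl, fun j hj => ⟨fun _ => hj, fun _ => hp j L (by omega) (by omega) hL⟩⟩
    · refine ⟨g, by omega, fun j hj => ?_⟩
      rcases Nat.lt_succ_iff_lt_or_eq.1 hj with hj | rfl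
      · exact h j hj
      · exact ⟨fun h' => absurd h' hL, fun h' => by omega⟩

/-- Points that lie below the upper envelope of some lines, from left to right, are covered by
a chain that uses each of the lines at most once. -/
theorem exists_chain_of_lines {cov : ℕ → ℕ → Prop} {w : ℕ → ℝ} (A B : ℕ → ℝ) (u v : ℕ → ℝ)
    (T : Finset ℕ) (hw : ∀ h ∈ T, 0 ≤ w h) (g : ℕ) (hu : ∀ i j, i ≤ j → j < g → u i ≤ u j)
    (hT : ∀ i < g, ∃ h ∈ T, v i ≤ A h * u i + B h)
    (hcov : ∀ i < g, ∀ h ∈ T, v i ≤ A h * u i + B h → cov i h) :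
    ∃ c ≤ ∑ h ∈ T, w h, Chain cov w g c := by
  -- The steepest line, once on top of the envelope, stays on top, so it can be assigned a final
  -- segment; the flatter lines handle the prefix by induction.
  induction T using Finset.induction_on_max_value A generalizing g with
  | empty =>
    rcases Nat.eq_zero_or_pos g with rfl | hg
    · exact ⟨0, by simp, .nil⟩
    · obtain ⟨h, hh, -⟩ := hT 0 hg
      simp at hh
  | insert a T ha hmax ih =>
    -- Some other line lies strictly above `a` exactly at the positions before `g'`.
    obtain ⟨g', hg', h⟩ := exists_threshold
      (fun i => ∃ h ∈ T, A a * u i + B a < A h * u i + B h) g (by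
        rintro i j hij hj ⟨h, hh, hlt⟩
        refine ⟨h, hh, ?_⟩
        nlinarith [mul_le_mul_of_nonneg_left (hu i j hij hj) (sub_nonneg.2 (hmax h hh))])
    obtain ⟨c, hc, hch⟩ := ih (fun h hh => hw h (Finset.mem_insert_of_mem hh)) g'
      (fun i j hij hj => hu i j hij (by omega))
      (fun i hi => by
        obtain ⟨h', hh', hlt⟩ := (h i (by omega)).2 hi
        obtain ⟨h'', hh'', hle⟩ := hT i (by omega)
        rcases Finset.mem_insert.1 hh'' with rfl | hm
        · exact ⟨h', hh', hle.trans hlt.le⟩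
        · exact ⟨h'', hm, hle⟩)
      (fun i hi h' hh' => hcov i (by omega) h' (Finset.mem_insert_of_mem hh'))
    rw [Finset.sum_insert ha]
    have hwa := hw a (Finset.mem_insert_self _ _)
    rcases Nat.lt_or_ge g' g with hlt | hge
    · refine ⟨c + w a, by linarith, .step hch hlt fun l hl hlg => ?_⟩
      refine hcov l hlg a (Finset.mem_insert_self _ _) ?_
      have hn : ¬ ∃ h ∈ T, A a * u l + B a < A h * u l + B h := fun hh =>
        absurd ((h l hlg).1 hh) (by omega)
      push Not at hn
      obtain ⟨h'', hh'', hle⟩ := hT l hlg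
      rcases Finset.mem_insert.1 hh'' with rfl | hm
      · exact hle
      · exact hle.trans (hn _ hm)
    · obtain rfl : g' = g := by omega
      exact ⟨c, by linarith, hch⟩

/-! ## Angular order -/

/-- The angle of the vector `(x, y)`. -/
noncomputable def angle (x y : ℝ) : ℝ := Complex.arg ⟨x, y⟩

/-- The vector `(x, y)` has an angle in the interval `(0, π]`. -/
def Upper (x y : ℝ) : Prop := 0 < y ∨ (y = 0 ∧ x < 0)

/-- `Complex.arg` takes values in (-π, π], so the negative real axis counts as upper and the
positive one does not. -/
theorem upper_iff (x y : ℝ) : Upper x y ↔ 0 < angle x y := by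
  unfold Upper angle
  constructor
  · rintro (h | ⟨rfl, h⟩)
    · refine lt_of_le_of_ne (Complex.arg_nonneg_iff.2 h.le) fun h0 => ?_
      have := (Complex.arg_eq_zero_iff.1 h0.symm).2
      simp at this; linarith
    · rw [Complex.arg_eq_pi_iff.2 ⟨h, rfl⟩]
      exact Real.pi_pos
  · intro h
    have h1 : 0 ≤ y := Complex.arg_nonneg_iff.1 h.le
    rcases h1.eq_or_lt with h1 | h1
    · right
      refine ⟨h1.symm, ?_⟩
      by_contra! hx
      exact h.ne' (Complex.arg_eq_zero_iff.2 ⟨hx, h1.symm⟩)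
    · exact .inl h1

theorem cross_eq_sin (x y x' y' : ℝ) :
    x * y' - y * x' =
      ‖(⟨x, y⟩ : ℂ)‖ * ‖(⟨x', y'⟩ : ℂ)‖ * Real.sin (angle x' y' - angle x y) := by
  have h1 := Complex.norm_mul_cos_arg ⟨x, y⟩
  have h2 := Complex.norm_mul_sin_arg ⟨x, y⟩
  have h3 := Complex.norm_mul_cos_arg ⟨x', y'⟩
  have h4 := Complex.norm_mul_sin_arg ⟨x', y'⟩
  simp only at h1 h2 h3 h4
  unfold angle
  rw [Real.sin_sub]
  linear_combination (-y') * h1 + x' * h2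
    + (‖(⟨x, y⟩ : ℂ)‖ * Real.sin (Complex.arg ⟨x, y⟩)) * h3
    - (‖(⟨x, y⟩ : ℂ)‖ * Real.cos (Complex.arg ⟨x, y⟩)) * h4

theorem norm_pos_of_ne {x y : ℝ} (h : x ≠ 0 ∨ y ≠ 0) : 0 < ‖(⟨x, y⟩ : ℂ)‖ := by
  rw [norm_pos_iff]
  intro h0
  have := Complex.ext_iff.1 h0
  simp at this
  tauto

theorem angle_le_pi (x y : ℝ) : angle x y ≤ Real.pi := Complex.arg_le_pi _

theorem neg_pi_lt_angle (x y : ℝ) : -Real.pi < angle x y := Complex.neg_pi_lt_arg _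

/-- Comparison of angles by exact arithmetic. -/
theorem angle_lt_iff {x y x' y' : ℝ} (h : x ≠ 0 ∨ y ≠ 0) (h' : x' ≠ 0 ∨ y' ≠ 0) :
    angle x y < angle x' y' ↔ (¬ Upper x y ∧ Upper x' y') ∨
      ((Upper x y ∧ Upper x' y' ∨ ¬ Upper x y ∧ ¬ Upper x' y') ∧ 0 < x * y' - y * x') := by
  have hr := mul_pos (norm_pos_of_ne h) (norm_pos_of_ne h')
  have hc : 0 < x * y' - y * x' ↔ 0 < Real.sin (angle x' y' - angle x y) := by
    rw [cross_eq_sin]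
    exact mul_pos_iff_of_pos_left hr
  rw [hc, upper_iff, upper_iff]
  have h1 := angle_le_pi x y
  have h2 := angle_le_pi x' y'
  have h3 := neg_pi_lt_angle x y
  have h4 := neg_pi_lt_angle x' y'
  generalize angle x y = α at *
  generalize angle x' y' = β at *
  -- Two angles in the same half (-π, 0] or (0, π] differ by less than π, where the sine has the
  -- sign of its argument.
  have key : |β - α| < Real.pi → (0 < Real.sin (β - α) ↔ α < β) := by
    intro hlt
    rw [abs_lt] at hlt
    constructor
    · intro hs
      by_contra! hle
      have := Real.sin_nonpos_of_nonpos_of_neg_pi_le (x := β - α) (by linarith) (by linarith)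
      linarith
    · intro hlt'
      exact Real.sin_pos_of_pos_of_lt_pi (by linarith) (by linarith)
  by_cases ha : 0 < α <;> by_cases hb : 0 < β
  · rw [key (by rw [abs_lt]; constructor <;> linarith)]
    simp [ha, hb]
  · simp only [ha, hb]
    simp
    linarith
  · simp only [ha, hb]
    simp
    linarith
  · rw [key (by rw [abs_lt]; constructor <;> linarith)]
    simp [ha, hb]

/-- The cyclic rotation by `k` of a sequence of length `L`. -/
def rotate (L k : ℕ) (x : ℕ → ℕ) (j : ℕ) : ℕ := if k + j < L then x (k + j) else x (k + j - L)

/-- In a cyclic order by angles that starts at the boundary of an open half-plane, the vectors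
in the half-plane come first, in their angular order. -/
theorem rotate_halfPlane {a b : ℝ} (hab : a ≠ 0 ∨ b ≠ 0) (L k : ℕ) (hk : k ≤ L) (x : ℕ → ℕ)
    (dx dy : ℕ → ℝ) (hne : ∀ i < L, dx (x i) ≠ 0 ∨ dy (x i) ≠ 0)
    (hsort : ∀ i j, i ≤ j → j < L → angle (dx (x i)) (dy (x i)) ≤ angle (dx (x j)) (dy (x j)))
    (hkβ : ∀ i < L, (angle (dx (x i)) (dy (x i)) ≤ angle b (-a) ↔ i < k)) :
    ∃ g ≤ L, (∀ j < L, 0 < a * dx (rotate L k x j) + b * dy (rotate L k x j) ↔ j < g) ∧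
      ∀ i j, i ≤ j → j < g → 0 ≤ dx (rotate L k x i) * dy (rotate L k x j)
        - dy (rotate L k x i) * dx (rotate L k x j) := by
  set β := angle b (-a) with hβ
  -- The angle measured from the boundary direction `(b, -a)` and unrolled at the cut: entries that
  -- wrap around gain 2π, which makes `φ` nondecreasing with values in (0, 2π].
  set φ : ℕ → ℝ := fun j => if k + j < L then angle (dx (x (k + j))) (dy (x (k + j))) - β
    else angle (dx (x (k + j - L))) (dy (x (k + j - L))) - β + 2 * Real.pi with hφ
  have hβ1 : β ≤ Real.pi := angle_le_pi _ _
  have hβ2 : -Real.pi < β := neg_pi_lt_angle _ _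
  have hpi := Real.pi_pos
  have hrot : ∀ j < L, ∃ i < L, rotate L k x j = x i := fun j hj => by
    unfold rotate
    split_ifs with h
    · exact ⟨_, h, rfl⟩
    · exact ⟨_, by omega, rfl⟩
  have hsin : ∀ j, Real.sin (φ j) =
      Real.sin (angle (dx (rotate L k x j)) (dy (rotate L k x j)) - β) := by
    intro j
    simp only [hφ, rotate]
    split_ifs
    · rfl
    · rw [Real.sin_add_two_pi]
  have hpos : ∀ j < L, 0 < φ j := fun j hj => by
    simp only [hφ]
    split_ifs with h
    · have := (hkβ (k + j) h).not.2 (by omega)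
      linarith
    · have := neg_pi_lt_angle (dx (x (k + j - L))) (dy (x (k + j - L)))
      linarith
  have hle : ∀ j < L, φ j ≤ 2 * Real.pi := fun j hj => by
    simp only [hφ]
    split_ifs with h
    · have := angle_le_pi (dx (x (k + j))) (dy (x (k + j)))
      linarith
    · have := (hkβ (k + j - L) (by omega)).2 (by omega)
      linarith
  have hmono : ∀ i j, i ≤ j → j < L → φ i ≤ φ j := fun i j hij hj => by
    simp only [hφ]
    split_ifs with h1 h2
    · linarith [hsort (k + i) (k + j) (by omega) h2]
    · have h3 := angle_le_pi (dx (x (k + i))) (dy (x (k + i)))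
      have := neg_pi_lt_angle (dx (x (k + j - L))) (dy (x (k + j - L)))
      linarith
    · omega
    · linarith [hsort (k + i - L) (k + j - L) (by omega) (by omega)]
  -- The dot product with `(a, b)` is the cross product with `(b, -a)`, a positive multiple of sin
  -- `φ`; on (0, 2π] this is positive exactly below π.
  have hdot : ∀ j < L, (0 < a * dx (rotate L k x j) + b * dy (rotate L k x j) ↔ φ j < Real.pi) := by
    intro j hj
    obtain ⟨i, hi, hri⟩ := hrot j hj
    have hr := mul_pos (norm_pos_of_ne (x := b) (y := -a) (by simpa [or_comm] using hab))
      (norm_pos_of_ne (hne i hi))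
    have h1 : a * dx (rotate L k x j) + b * dy (rotate L k x j)
        = b * dy (rotate L k x j) - (-a) * dx (rotate L k x j) := by ring
    rw [h1, cross_eq_sin, ← hβ, ← hsin, hri, mul_pos_iff_of_pos_left hr]
    constructor
    · intro hs
      by_contra! hge
      have := Real.sin_nonneg_of_nonneg_of_le_pi (x := φ j - Real.pi) (by linarith)
        (by linarith [hle j hj])
      rw [Real.sin_sub_pi] at this
      linarith
    · exact Real.sin_pos_of_pos_of_lt_pi (hpos j hj)
  obtain ⟨g, hg, hgt⟩ := exists_threshold (fun j => φ j < Real.pi) L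
    fun i j hij hj h => (hmono i j hij hj).trans_lt h
  refine ⟨g, hg, fun j hj => (hdot j hj).trans (hgt j hj), fun i j hij hj => ?_⟩
  rw [cross_eq_sin]
  refine mul_nonneg (by positivity) ?_
  have h1 : Real.sin (φ j - φ i) = Real.sin (angle (dx (rotate L k x j)) (dy (rotate L k x j))
      - angle (dx (rotate L k x i)) (dy (rotate L k x i))) := by
    simp only [hφ, rotate]
    split_ifs
    · congr 1; ring
    · omega
    · conv_rhs => rw [← Real.sin_add_two_pi]
      congr 1; ring
    · congr 1; ring
  rw [← h1]
  have h2 := (hgt j (by omega)).2 hj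
  exact Real.sin_nonneg_of_nonneg_of_le_pi (by linarith [hmono i j hij (by omega)])
    (by linarith [hpos i (by omega)])

/-! ## The structure of a minimum-weight coverage -/

/-- The half-planes in `T` cover the points `0, …, n - 1`. -/
def CoversIndices (n : ℕ) (cov : ℕ → ℕ → Prop) (T : Finset ℕ) : Prop :=
  ∀ i < n, ∃ h ∈ T, cov i h

theorem CoversIndices.exists_minimal {n : ℕ} {cov : ℕ → ℕ → Prop} {T : Finset ℕ}
    (hT : CoversIndices n cov T) :
    ∃ T' ⊆ T, CoversIndices n cov T' ∧ ∀ h ∈ T', ¬ CoversIndices n cov (T'.erase h) := by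
  induction T using Finset.strongInduction with
  | H T ih =>
    by_cases h : ∃ h ∈ T, CoversIndices n cov (T.erase h)
    · obtain ⟨h, hh, hc⟩ := h
      obtain ⟨T', hs, h'⟩ := ih _ (Finset.erase_ssubset hh) hc
      exact ⟨T', hs.trans (Finset.erase_subset _ _), h'⟩
    · push Not at h
      exact ⟨T, Finset.Subset.refl _, hT, h⟩

/-- The point `i` lies in the half-plane `h`. -/
def InHalfPlane (X Y a b c : ℕ → ℝ) (i h : ℕ) : Prop := a h * X i + b h * Y i ≤ c h

/-- The points other than `p` in the order `x`, rotated by `k`, and finally `p`. -/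
def pointOrder (L k : ℕ) (x : ℕ → ℕ) (p j : ℕ) : ℕ := if j < L then rotate L k x j else p

/-- In every angular order around the point `p` that starts at the boundary of the half-plane
`h`, there is a chain of weight at most `z`. -/
def CheapChain (X Y a b c w : ℕ → ℝ) (n m p h : ℕ) (z : ℝ) : Prop :=
  ∀ (L k : ℕ) (x : ℕ → ℕ), k ≤ L →
    (∀ i < L, x i < n ∧ (X (x i) - X p ≠ 0 ∨ Y (x i) - Y p ≠ 0)) →
    (∀ i j, i ≤ j → j < L →
      angle (X (x i) - X p) (Y (x i) - Y p) ≤ angle (X (x j) - X p) (Y (x j) - Y p)) →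
    (∀ i < L, angle (X (x i) - X p) (Y (x i) - Y p) ≤ angle (b h) (-a h) ↔ i < k) →
    ∃ cost ≤ z,
      Chain (fun j h => h < m ∧ InHalfPlane X Y a b c (pointOrder L k x p j) h) w (L + 1) cost

/-- The centre is a private point of `h`, chosen extremal for `h`. Projection from it turns the
other half-planes of a minimal coverage into regions under lines, and `h` covers everything that the
projection does not reach. -/
theorem exists_cheapChain {X Y a b c w : ℕ → ℝ} {n m : ℕ} (hn : 0 < n)
    (hab : ∀ h < m, a h ≠ 0 ∨ b h ≠ 0) (hw : ∀ h < m, 0 < w h) {T : Finset ℕ}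
    (hTm : T ⊆ Finset.range m) (hT : CoversIndices n (InHalfPlane X Y a b c) T) :
    ∃ p < n, ∃ h < m, CheapChain X Y a b c w n m p h (∑ h ∈ T, w h) := by
  obtain ⟨T', hsub, hcov, hmin⟩ := hT.exists_minimal
  have hlt : ∀ h ∈ T', h < m := fun h hh => Finset.mem_range.1 (hTm (hsub hh))
  obtain ⟨h, hh, -⟩ := hcov 0 hn
  classical
  -- The points for which `h` is indispensable; minimality makes this set nonempty.
  set R := (Finset.range n).filter fun i => ∀ h' ∈ T'.erase h, ¬ InHalfPlane X Y a b c i h' with hR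
  have hRne : R.Nonempty := by
    have := hmin h hh
    unfold CoversIndices at this
    push Not at this
    obtain ⟨i, hi, h'⟩ := this
    exact ⟨i, by simpa [hR, hi] using h'⟩
  obtain ⟨p, hpR, hpmax⟩ := R.exists_max_image (fun i => a h * X i + b h * Y i) hRne
  obtain ⟨hpn, hpriv⟩ := Finset.mem_filter.1 hpR
  rw [Finset.mem_range] at hpn
  have hph : InHalfPlane X Y a b c p h := by
    obtain ⟨h', hh', hc⟩ := hcov p hpn
    by_cases he : h' = h
    · exact he ▸ hc
    · exact absurd hc (hpriv h' (Finset.mem_erase.2 ⟨he, hh'⟩))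
  refine ⟨p, hpn, h, hlt h hh, fun L k x hk hx hsort hkβ => ?_⟩
  obtain ⟨g, hg, hg1, hg2⟩ := rotate_halfPlane (hab h (hlt h hh)) L k hk x (fun i => X i - X p)
    (fun i => Y i - Y p) (fun i hi => (hx i hi).2) hsort hkβ
  have hrot : ∀ j < L, rotate L k x j < n := fun j hj => by
    unfold rotate
    split_ifs with h
    · exact (hx _ h).1
    · exact (hx _ (by omega)).1
  set y := rotate L k x with hy
  -- `σ` and `τ` are the unnormalized coordinates relative to `p` along the normal and the boundary
  -- of `h`; `δ` measures by how much `h'` misses `p`.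
  set σ : ℕ → ℝ := fun j => a h * (X (y j) - X p) + b h * (Y (y j) - Y p) with hσ
  set τ : ℕ → ℝ := fun j => -b h * (X (y j) - X p) + a h * (Y (y j) - Y p) with hτ
  set δ : ℕ → ℝ := fun h' => a h' * X p + b h' * Y p - c h' with hδ
  set N : ℝ := a h ^ 2 + b h ^ 2 with hN
  have hNpos : 0 < N := by
    rcases hab h (hlt h hh) with h0 | h0
    · have := sq_pos_of_ne_zero h0
      positivity
    · have := sq_pos_of_ne_zero h0
      positivity
  have hσpos : ∀ j < g, 0 < σ j := fun j hj => (hg1 j (by omega)).2 hj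
  have hδpos : ∀ h' ∈ T'.erase h, 0 < δ h' := fun h' hh' => by
    have := hpriv h' hh'
    unfold InHalfPlane at this
    simp only [hδ]
    linarith
  -- The line that represents `h'` after the projection: right side minus left side is the slack of
  -- the point in `h'` divided by `δ h' * σ j`, which is positive.
  have hline : ∀ j < g, ∀ h' ∈ T'.erase h, (InHalfPlane X Y a b c (y j) h' ↔
      1 / σ j ≤ (-(a h' * -b h + b h' * a h) / (N * δ h')) * (τ j / σ j)
        + -(a h' * a h + b h' * b h) / (N * δ h')) := by
    intro j hj h' hh'
    have h1 := hσpos j hj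
    have h2 := hδpos h' hh'
    have h3 : (-(a h' * -b h + b h' * a h) / (N * δ h')) * (τ j / σ j)
        + -(a h' * a h + b h' * b h) / (N * δ h') - 1 / σ j
        = (c h' - (a h' * X (y j) + b h' * Y (y j))) / (δ h' * σ j) := by
      have h4 : c h' = a h' * X p + b h' * Y p - δ h' := by simp only [hδ]; ring
      rw [h4]
      field_simp
      simp only [hτ, hσ, hN]
      ring
    unfold InHalfPlane
    rw [← sub_nonneg, ← sub_nonneg (b := 1 / σ j), h3]
    rw [le_div_iff₀ (by positivity), zero_mul]
  obtain ⟨cost, hcost, hch⟩ := exists_chain_of_lines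
    (cov := fun j h => h < m ∧ InHalfPlane X Y a b c (pointOrder L k x p j) h) (w := w)
    (fun h' => -(a h' * -b h + b h' * a h) / (N * δ h'))
    (fun h' => -(a h' * a h + b h' * b h) / (N * δ h'))
    (fun j => τ j / σ j) (fun j => 1 / σ j) (T'.erase h)
    (fun h' hh' => (hw h' (hlt h' (Finset.mem_of_mem_erase hh'))).le) g
    (by
      intro i j hij hj
      have h1 := hσpos i (by omega)
      have h2 := hσpos j hj
      rw [div_le_div_iff₀ h1 h2, ← sub_nonneg]
      -- The change to the coordinates `σ`, `τ` multiplies cross products by `N` up to orientation,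
      -- so angular order becomes order of slopes `τ / σ`.
      have h3 : τ j * σ i - τ i * σ j = N * ((X (y i) - X p) * (Y (y j) - Y p)
        - (Y (y i) - Y p) * (X (y j) - X p)) := by
        simp only [hτ, hσ, hN]
        ring
      rw [h3]
      exact mul_nonneg hNpos.le (hg2 i j hij hj))
    (by
      intro j hj
      -- A point above every line would be private to `h` and strictly beyond `p`, against the
      -- choice of `p`.
      by_contra! hno
      have hmem : y j ∈ R := by
        refine Finset.mem_filter.2 ⟨Finset.mem_range.2 (hrot j (by omega)), fun h' hh' hc => ?_⟩
        exact absurd ((hline j hj h' hh').1 hc) (not_le.2 (hno h' hh'))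
      have h1 := hpmax _ hmem
      have h2 := hσpos j hj
      simp only [hσ] at h2
      linarith)
    (by
      intro j hj h' hh' hle
      refine ⟨hlt h' (Finset.mem_of_mem_erase hh'), ?_⟩
      unfold pointOrder
      rw [if_pos (by omega)]
      exact (hline j hj h' hh').2 hle)
  -- The positions from `g` to `L` form the interval of `h`. It is never empty, since position `L`
  -- holds `p`.
  refine ⟨cost + w h, ?_, .step hch (by omega) fun l hl hl' => ⟨hlt h hh, ?_⟩⟩
  · calc cost + w h ≤ ∑ h' ∈ T'.erase h, w h' + w h := by linarith
      _ = ∑ h' ∈ T', w h' := Finset.sum_erase_add _ _ hh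
      _ ≤ ∑ h' ∈ T, w h' := Finset.sum_le_sum_of_subset_of_nonneg hsub
        fun i hi _ => (hw i (Finset.mem_range.1 (hTm hi))).le
  · unfold pointOrder
    split_ifs with hlL
    · have h1 := (hg1 l hlL).not.2 (by omega)
      unfold InHalfPlane at hph ⊢
      simp only [← hy] at h1 ⊢
      linarith
    · exact hph

/-! ## Sorting by ranks -/

/-- The number of elements of `V` that come before `q` when ordered by `f` and then by index. -/
noncomputable def rank (f : ℕ → ℝ) (V : Finset ℕ) (q : ℕ) : ℕ :=
  (V.filter fun r => f r < f q ∨ (f r = f q ∧ r < q)).card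

theorem rank_lt_rank {f : ℕ → ℝ} {V : Finset ℕ} {q r : ℕ} (hr : r ∈ V)
    (h : f r < f q ∨ (f r = f q ∧ r < q)) : rank f V r < rank f V q := by
  refine Finset.card_lt_card (Finset.ssubset_iff_of_subset ?_ |>.2 ⟨r, ?_, ?_⟩)
  · refine Finset.monotone_filter_right _ fun s _ hs => ?_
    grind
  · simp [hr, h]
  · simp

theorem rank_lt_card {f : ℕ → ℝ} {V : Finset ℕ} {q : ℕ} (hq : q ∈ V) : rank f V q < V.card :=
  Finset.card_lt_card (Finset.filter_ssubset.2 ⟨q, hq, by simp⟩)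

/-- Ties are broken by index, so ranks are distinct even for collinear or repeated points. -/
theorem rank_injOn {f : ℕ → ℝ} {V : Finset ℕ} : Set.InjOn (rank f V) V := by
  intro q hq r hr h
  by_contra hne
  rcases lt_trichotomy (f q) (f r) with hlt | heq | hgt
  · exact (rank_lt_rank hq (.inl hlt)).ne h
  · rcases Nat.lt_or_gt_of_ne hne with hlt | hgt
    · exact (rank_lt_rank hq (.inr ⟨heq, hlt⟩)).ne h
    · exact (rank_lt_rank hr (.inr ⟨heq.symm, hgt⟩)).ne' h
  · exact (rank_lt_rank hr (.inl hgt)).ne' h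

theorem exists_rank_eq {f : ℕ → ℝ} {V : Finset ℕ} {i : ℕ} (hi : i < V.card) :
    ∃ q ∈ V, rank f V q = i := by
  have h : V.image (rank f V) = Finset.range V.card := by
    refine Finset.eq_of_subset_of_card_le (fun j hj => ?_) ?_
    · obtain ⟨q, hq, rfl⟩ := Finset.mem_image.1 hj
      exact Finset.mem_range.2 (rank_lt_card hq)
    · rw [Finset.card_image_of_injOn rank_injOn, Finset.card_range]
  simpa using (h ▸ Finset.mem_range.2 hi : i ∈ V.image (rank f V))

theorem sorted_of_rank {f : ℕ → ℝ} {V : Finset ℕ} {x : ℕ → ℕ} (hx : ∀ q ∈ V, x (rank f V q) = q)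
    {i j : ℕ} (hij : i ≤ j) (hj : j < V.card) : f (x i) ≤ f (x j) := by
  obtain ⟨q, hq, rfl⟩ := exists_rank_eq (f := f) (hij.trans_lt hj)
  obtain ⟨r, hr, rfl⟩ := exists_rank_eq (f := f) hj
  rw [hx q hq, hx r hr]
  by_contra! h
  exact absurd (rank_lt_rank hr (.inl h)) (by omega)

theorem mem_of_rank {f : ℕ → ℝ} {V : Finset ℕ} {x : ℕ → ℕ} (hx : ∀ q ∈ V, x (rank f V q) = q)
    {i : ℕ} (hi : i < V.card) : x i ∈ V := by
  obtain ⟨q, hq, rfl⟩ := exists_rank_eq (f := f) hi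
  rwa [hx q hq]

/-- This identifies the start of a rotation by counting alone, without a search in the sorted array.
-/
theorem le_iff_of_rank {f : ℕ → ℝ} {V : Finset ℕ} {x : ℕ → ℕ} (hx : ∀ q ∈ V, x (rank f V q) = q)
    (β : ℝ) {i : ℕ} (hi : i < V.card) : f (x i) ≤ β ↔ i < (V.filter fun q => f q ≤ β).card := by
  obtain ⟨q, hq, rfl⟩ := exists_rank_eq (f := f) hi
  rw [hx q hq]
  constructor
  · intro h
    refine Finset.card_lt_card (Finset.ssubset_iff_of_subset ?_ |>.2 ⟨q, ?_, ?_⟩)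
    · refine Finset.monotone_filter_right _ fun s _ hs => ?_
      rcases hs with hs | hs <;> linarith
    · simp [hq, h]
    · simp
  · intro h
    by_contra! hlt
    refine absurd (Finset.card_le_card (?_ : V.filter (fun q => f q ≤ β) ⊆
      V.filter fun r => f r < f q ∨ (f r = f q ∧ r < q))) (not_le.2 h)
    refine Finset.monotone_filter_right _ fun s _ hs => ?_
    exact .inl (lt_of_le_of_lt hs hlt)

end HalfPlaneCoverage

/-! ## The program -/

namespace HalfPlaneCoverage

open RealRAM

/-! ### Inputs as sequences and their place in memory. -/

/-- The number of points and of half-planes, and the coordinates, coefficients and weights. -/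
structure IndexedInput where
  n : ℕ
  m : ℕ
  X : ℕ → ℝ
  Y : ℕ → ℝ
  a : ℕ → ℝ
  b : ℕ → ℝ
  c : ℕ → ℝ
  w : ℕ → ℝ

namespace IndexedInput

/-- The point `i` lies in the half-plane `h`. -/
def In (d : IndexedInput) (i h : ℕ) : Prop := InHalfPlane d.X d.Y d.a d.b d.c i h

/-- The angle at which the point `q` is seen from the point `p`. -/
noncomputable def ang (d : IndexedInput) (p q : ℕ) : ℝ := angle (d.X q - d.X p) (d.Y q - d.Y p)

open Classical in
/-- The points that differ from `p`. -/
noncomputable def others (d : IndexedInput) (p : ℕ) : Finset ℕ :=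
  (Finset.range d.n).filter fun q => d.X q - d.X p ≠ 0 ∨ d.Y q - d.Y p ≠ 0

end IndexedInput

/-- The memory `s` holds the input `d`. -/
structure HasInput (d : IndexedInput) (s : Mem) : Prop where
  n : s.var 0 = d.n
  m : s.var 1 = d.m
  X : s.real 0 = d.X
  Y : s.real 1 = d.Y
  a : s.real 2 = d.a
  b : s.real 3 = d.b
  c : s.real 4 = d.c
  w : s.real 5 = d.w

theorem HasInput.same {d : IndexedInput} {s s' : Mem} {A : Program} (h : HasInput d s)
    (hs : Same A s s') (hv : ∀ x < 2, A.writesVar x = false)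
    (hr : ∀ a < 6, A.writesReal a = false) : HasInput d s' where
  n := (hs.var 0 (hv 0 (by norm_num))).trans h.n
  m := (hs.var 1 (hv 1 (by norm_num))).trans h.m
  X := (hs.real 0 (hr 0 (by norm_num))).trans h.X
  Y := (hs.real 1 (hr 1 (by norm_num))).trans h.Y
  a := (hs.real 2 (hr 2 (by norm_num))).trans h.a
  b := (hs.real 3 (hr 3 (by norm_num))).trans h.b
  c := (hs.real 4 (hr 4 (by norm_num))).trans h.c
  w := (hs.real 5 (hr 5 (by norm_num))).trans h.w

/-! ### Counting and sorting -/

/-- Set the variable `y` to the number of `x < n` that satisfy the test `b`. -/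
def countProg (x y : ℕ) (b : Test) : Program :=
  .seq (.assign y (.const 0))
    (.forLoop x (.var 0) (.ite b (.assign y (.add (.var y) (.const 1))) .skip))

theorem runs_countProg {W : ℕ} {d : IndexedInput} {s : Mem} {x y : ℕ} {b : Test} (P : ℕ → Prop)
    [DecidablePred P] (hx : x ≠ 0) (hy : y ≠ 0) (hxy : x ≠ y) (hn : s.var 0 = d.n) (hW : d.n ≤ W)
    (hb : ∀ i s', i < d.n → s'.var x = i → Same (countProg x y b) s s' → (b.Holds s' ↔ P i)) :
    Runs W (countProg x y b) s (d.n * (b.cost + 16) + 16)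
      (fun s' => s'.var y = ((Finset.range d.n).filter P).card) := by
  have hx0 : (0 == x) = false := by simpa using hx.symm
  have hy0 : (0 == y) = false := by simpa using hy.symm
  refine Runs.seq_mid 2 (d.n * (b.cost + 16) + 14) (by omega)
    (R := fun s' => s'.var y = 0 ∧ s'.var 0 = d.n)
    (Runs.assign (by simp) (by simp [NatExpr.cost]) (by simpa [hy.symm] using hn)) ?_
  rintro s₁ hs₁ ⟨h1, h2⟩
  refine Runs.forLoop d.n (b.cost + 5)
    (fun i s' => s'.var y = ((Finset.range i).filter P).card) hW ?_ ?_ ?_ ?_ ?_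
  · simp only [NatExpr.cost]
    have : 1 + (b.cost + 5) + 8 ≤ b.cost + 16 := by omega
    have := Nat.mul_le_mul_left d.n this
    omega
  · simpa [hxy.symm] using h1
  · intro i s' _ _ _ hs'
    have := hs'.var 0 (by simp [Program.forLoop, Program.writesVar, hx0, hy0])
    simpa [this] using h2
  · intro i s' hi hI hxi hs'
    have hP := hb i s' hi hxi (hs₁.seq_left.trans hs'.seq_right)
    refine Runs.ite 4 (by omega) (fun h => ?_) (fun h => ?_)
    · have hc : ((Finset.range i).filter P).card ≤ i := by
        simpa using Finset.card_filter_le (Finset.range i) P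
      refine Runs.assign (by simp; omega) (by simp [NatExpr.cost]) ?_
      simp [hxy, hxy.symm, hxi, Finset.range_add_one, Finset.filter_insert, hP.1 h, hI]
    · refine Runs.skip (by norm_num) ?_
      simp [hxy.symm, hxi, Finset.range_add_one, Finset.filter_insert, hP.not.1 h, hI]
  · intro s' hI _ _
    exact hI

/-- The test whether the vector `(x, y)` has an angle in `(0, π]`. -/
def upperTest (x y : RealExpr) : Test :=
  .disj (.neg (.realLe y (.const 0))) (.conj (.realEq y (.const 0)) (.neg (.realLe (.const 0) x)))

/-- The test whether the angle of `(x, y)` is less than the angle of `(x', y')`. -/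
def angleTest (x y x' y' : RealExpr) : Test :=
  .disj (.conj (.neg (upperTest x y)) (upperTest x' y'))
    (.conj (.disj (.conj (upperTest x y) (upperTest x' y'))
        (.conj (.neg (upperTest x y)) (.neg (upperTest x' y'))))
      (.neg (.realLe (.sub (.mul x y') (.mul y x')) (.const 0))))

theorem upperTest_holds (s : Mem) (x y : RealExpr) :
    (upperTest x y).Holds s ↔ Upper (x.eval s) (y.eval s) := by
  simp [upperTest, Upper]

theorem angleTest_holds (s : Mem) (x y x' y' : RealExpr)
    (h : x.eval s ≠ 0 ∨ y.eval s ≠ 0) (h' : x'.eval s ≠ 0 ∨ y'.eval s ≠ 0) :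
    (angleTest x y x' y').Holds s ↔
      angle (x.eval s) (y.eval s) < angle (x'.eval s) (y'.eval s) := by
  rw [angle_lt_iff h h']
  simp only [angleTest, Test.Holds, upperTest_holds, RealExpr.eval, Rat.cast_zero, not_le]

/-- The first coordinate of the vector from the point `var 2` to the point `var q`. -/
def vecX (q : ℕ) : RealExpr := .sub (.get 0 (.var q)) (.get 0 (.var 2))

/-- The second coordinate of the vector from the point `var 2` to the point `var q`. -/
def vecY (q : ℕ) : RealExpr := .sub (.get 1 (.var q)) (.get 1 (.var 2))

/-- The test whether the point `var q` differs from the point `var 2`. -/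
def otherTest (q : ℕ) : Test :=
  .disj (.neg (.realEq (vecX q) (.const 0))) (.neg (.realEq (vecY q) (.const 0)))

/-- The test whether the point `var r` comes before the point `var q` as seen from `var 2`. -/
def beforeTest (r q : ℕ) : Test :=
  .disj (angleTest (vecX r) (vecY r) (vecX q) (vecY q))
    (.conj (.neg (angleTest (vecX q) (vecY q) (vecX r) (vecY r)))
      (.neg (.natLe (.var q) (.var r))))

theorem vecX_eval {d : IndexedInput} {s : Mem} (h : HasInput d s) (q : ℕ) :
    (vecX q).eval s = d.X (s.var q) - d.X (s.var 2) := by simp [vecX, h.X]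

theorem vecY_eval {d : IndexedInput} {s : Mem} (h : HasInput d s) (q : ℕ) :
    (vecY q).eval s = d.Y (s.var q) - d.Y (s.var 2) := by simp [vecY, h.Y]

theorem otherTest_holds {d : IndexedInput} {s : Mem} (h : HasInput d s) {q : ℕ}
    (hq : s.var q < d.n) : (otherTest q).Holds s ↔ s.var q ∈ d.others (s.var 2) := by
  simp only [otherTest, Test.Holds, vecX_eval h, vecY_eval h, RealExpr.eval, Rat.cast_zero]
  simp [IndexedInput.others, hq]

theorem mem_others {d : IndexedInput} {p q : ℕ} :
    q ∈ d.others p ↔ q < d.n ∧ (d.X q - d.X p ≠ 0 ∨ d.Y q - d.Y p ≠ 0) := by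
  simp [IndexedInput.others]

/-- Equality of angles is expressed by the failure of a strict comparison each way, so only rational
operations are used. -/
theorem beforeTest_holds {d : IndexedInput} {s : Mem} (h : HasInput d s) {q r : ℕ}
    (hq : s.var q ∈ d.others (s.var 2)) (hr : s.var r ∈ d.others (s.var 2)) :
    (beforeTest r q).Holds s ↔ d.ang (s.var 2) (s.var r) < d.ang (s.var 2) (s.var q) ∨
      (d.ang (s.var 2) (s.var r) = d.ang (s.var 2) (s.var q) ∧ s.var r < s.var q) := by
  have h1 := angleTest_holds s (vecX r) (vecY r) (vecX q) (vecY q)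
    (by rw [vecX_eval h, vecY_eval h]; exact (mem_others.1 hr).2)
    (by rw [vecX_eval h, vecY_eval h]; exact (mem_others.1 hq).2)
  have h2 := angleTest_holds s (vecX q) (vecY q) (vecX r) (vecY r)
    (by rw [vecX_eval h, vecY_eval h]; exact (mem_others.1 hq).2)
    (by rw [vecX_eval h, vecY_eval h]; exact (mem_others.1 hr).2)
  rw [vecX_eval h, vecY_eval h, vecX_eval h, vecY_eval h] at h1 h2
  simp only [beforeTest, Test.Holds, h1, h2, NatExpr.eval, not_lt, not_le, IndexedInput.ang]
  grind

/-- Sort the points other than the point `var 2` by angle into the array `1`, and set `var 5` to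
the number of these points. -/
def sortProg : Program :=
  .seq (.assign 5 (.const 0))
    (.forLoop 3 (.var 0) (.ite (otherTest 3)
      (.seq (countProg 4 6 (.conj (otherTest 4) (beforeTest 4 3)))
        (.seq (.storeNat 1 (.var 6) (.var 3)) (.assign 5 (.add (.var 5) (.const 1)))))
      .skip))

/-- Each point is written directly to the cell given by its rank, and the rank is found by counting.
The quadratic time per centre adds up to O(n³), which the claimed bounds allow. -/
theorem runs_sortProg {W : ℕ} {d : IndexedInput} {s : Mem} (h : HasInput d s) (hW : d.n ≤ W) :
    Runs W sortProg s (d.n * (1000 * d.n + 1000) + 20) (fun s' =>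
      s'.var 5 = (d.others (s.var 2)).card ∧
      ∀ q ∈ d.others (s.var 2), s'.arr 1 (rank (d.ang (s.var 2)) (d.others (s.var 2)) q) = q) := by
  classical
  set p := s.var 2 with hp
  set V := d.others p with hV
  set f := d.ang p with hf
  refine Runs.seq_mid 2 (d.n * (1000 * d.n + 1000) + 18) (by omega)
    (R := fun s' => s'.var 5 = 0) (Runs.assign (by simp) (by simp [NatExpr.cost]) (by simp)) ?_
  rintro s₁ hs₁ h1
  refine Runs.forLoop d.n (1000 * d.n + 600)
    (fun i s' => s'.var 5 = ((Finset.range i).filter (· ∈ V)).card ∧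
      ∀ q ∈ V, q < i → s'.arr 1 (rank f V q) = q) hW ?_ ?_ ?_ ?_ ?_
  · simp only [NatExpr.cost]
    have : 1 + (1000 * d.n + 600) + 8 ≤ 1000 * d.n + 1000 := by omega
    have := Nat.mul_le_mul_left d.n this
    linarith
  · simpa using h1
  · intro i s' _ _ _ hs'
    have := (h.same (hs₁.seq_left.trans hs'.seq_right) (by decide) (by decide)).n
    simpa using this
  · rintro i s₂ hi ⟨hI1, hI2⟩ hxi hs₂
    have hsame := hs₁.seq_left.trans hs₂.seq_right
    have hin := h.same hsame (by decide) (by decide)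
    have hp2 : s₂.var 2 = p := hsame.var 2 (by decide)
    have ho := otherTest_holds hin (q := 3) (by omega)
    rw [hxi, hp2, ← hV] at ho
    refine Runs.ite (1000 * d.n + 400) ?_ (fun hh => ?_) (fun hh => ?_)
    · have : (otherTest 3).cost ≤ 100 := by decide
      omega
    · have hiV := ho.1 hh
      refine Runs.seq_mid (d.n * (1000) + 16) 200 (by omega)
        (R := fun s' => s'.var 6 = rank f V i) ?_ ?_
      · refine (runs_countProg (d := d) (fun r => r ∈ V ∧ (f r < f i ∨ (f r = f i ∧ r < i)))
          (by norm_num) (by norm_num) (by norm_num) hin.n hW ?_).mono ?_ ?_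
        · intro r s₃ hr hr4 hs₃
          have hin₃ := hin.same hs₃ (by decide) (by decide)
          have hp3 : s₃.var 2 = p := (hs₃.var 2 (by decide)).trans hp2
          have hq3 : s₃.var 3 = i := (hs₃.var 3 (by decide)).trans hxi
          have ho4 := otherTest_holds hin₃ (q := 4) (by omega)
          rw [hr4, hp3, ← hV] at ho4
          rw [Test.Holds, ho4]
          refine and_congr_right fun hrV => ?_
          have := beforeTest_holds hin₃ (q := 3) (r := 4) (by rwa [hq3, hp3]) (by rwa [hr4, hp3])
          rwa [hr4, hp3, hq3] at this
        · have : (Test.conj (otherTest 4) (beforeTest 4 3)).cost + 16 ≤ 1000 := by decide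
          have := Nat.mul_le_mul_left d.n this
          omega
        · intro s' _ hs'
          rw [hs', rank]
          congr 1
          ext r
          simp only [Finset.mem_filter, Finset.mem_range]
          constructor
          · rintro ⟨-, h⟩
            exact h
          · rintro h
            exact ⟨(mem_others.1 h.1).1, h⟩
      · intro s₃ hs₃ h6
        have h3 : s₃.var 3 = i := (hs₃.var 3 (by decide)).trans hxi
        have h5 : s₃.var 5 = ((Finset.range i).filter (· ∈ V)).card :=
          (hs₃.var 5 (by decide)).trans hI1
        have ha : s₃.arr 1 = s₂.arr 1 := hs₃.arr 1 (by decide)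
        have hrk : rank f V i < d.n := (rank_lt_card hiV).trans_le (by
          simpa [hV, IndexedInput.others] using Finset.card_filter_le (Finset.range d.n) _)
        have hc : ((Finset.range i).filter (· ∈ V)).card ≤ i := by
          simpa using Finset.card_filter_le (Finset.range i) (· ∈ V)
        refine Runs.seq 10 10 (by norm_num) ?_
        refine Runs.storeNat (by simp; omega) (by simp; omega) (by simp [NatExpr.cost]) ?_
        refine Runs.assign (by simp; omega) (by simp [NatExpr.cost]) ?_
        refine ⟨by simpa using h3, ?_, ?_⟩
        · simp [h5, Finset.range_add_one, Finset.filter_insert, hiV]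
        · intro q hq hqi
          simp only [Mem.setVar_arr, Mem.setArr_arr, if_true, NatExpr.eval, h6, h3, ha]
          rcases Nat.lt_succ_iff_lt_or_eq.1 hqi with hlt | rfl
          -- Distinct ranks keep the cells written earlier intact.
          · rw [Function.update_of_ne, hI2 q hq hlt]
            exact fun he => hlt.ne (rank_injOn hq hiV he)
          · simp
    · have hiV := ho.not.1 hh
      refine Runs.skip (by omega) ⟨hxi, ?_, ?_⟩
      · simp [hI1, Finset.range_add_one, Finset.filter_insert, hiV]
      · intro q hq hqi
        rcases Nat.lt_succ_iff_lt_or_eq.1 hqi with hlt | rfl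
        · exact hI2 q hq hlt
        · exact absurd hq hiV
  · rintro s' ⟨h5, h6⟩ - -
    refine ⟨?_, fun q hq => h6 q hq (mem_others.1 hq).1⟩
    rw [h5]
    congr 1
    ext r
    simp only [Finset.mem_filter, Finset.mem_range]
    exact ⟨fun h => h.2, fun h => ⟨(mem_others.1 h).1, h⟩⟩

/-! ### Rotations -/

/-- Set `var 8` to the start of a rotation: either to `var 7`, or to the number of points that
come up to the boundary of the half-plane `var 7` in the angular order. -/
def startProg : Bool → Program
  | true => .assign 8 (.var 7)
  | false => countProg 3 8 (.conj (otherTest 3)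
      (.neg (angleTest (.get 3 (.var 7)) (.sub (.const 0) (.get 2 (.var 7))) (vecX 3) (vecY 3))))

/-- The start of a rotation. -/
noncomputable def startIndex (d : IndexedInput) (p i : ℕ) : Bool → ℕ
  | true => i
  | false => ((d.others p).filter fun q => d.ang p q ≤ angle (d.b i) (-d.a i)).card

theorem runs_startProg {W : ℕ} {d : IndexedInput} {s : Mem} (mode : Bool) (h : HasInput d s)
    (hW : d.n ≤ W) (hi : mode = true → s.var 7 ≤ d.n)
    (hab : mode = false → d.a (s.var 7) ≠ 0 ∨ d.b (s.var 7) ≠ 0) :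
    Runs W (startProg mode) s (1000 * d.n + 20)
      (fun s' => s'.var 8 = startIndex d (s.var 2) (s.var 7) mode) := by
  classical
  cases mode with
  | true =>
    exact Runs.assign (by simpa using (hi rfl).trans hW) (by simp [NatExpr.cost])
      (by simp [startIndex])
  | false =>
    refine (runs_countProg (d := d) (fun q => q ∈ d.others (s.var 2) ∧
      d.ang (s.var 2) q ≤ angle (d.b (s.var 7)) (-d.a (s.var 7)))
      (by norm_num) (by norm_num) (by norm_num) h.n hW ?_).mono ?_ ?_
    · intro q s' hq hq3 hs'
      have hin := h.same hs' (by decide) (by decide)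
      have hp2 : s'.var 2 = s.var 2 := hs'.var 2 (by decide)
      have hp7 : s'.var 7 = s.var 7 := hs'.var 7 (by decide)
      have ho := otherTest_holds hin (q := 3) (by omega)
      rw [hq3, hp2] at ho
      rw [Test.Holds, ho]
      refine and_congr_right fun hqV => ?_
      rw [Test.Holds, angleTest_holds, vecX_eval hin, vecY_eval hin, hq3, hp2]
      · simp [hin.a, hin.b, hp7, IndexedInput.ang]
      · simpa [hin.a, hin.b, hp7, or_comm] using hab rfl
      · rw [vecX_eval hin, vecY_eval hin, hq3, hp2]
        exact (mem_others.1 hqV).2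
    · have : (Test.conj (otherTest 3) (.neg (angleTest (.get 3 (.var 7))
        (.sub (.const 0) (.get 2 (.var 7))) (vecX 3) (vecY 3)))).cost + 16 ≤ 1000 := by decide
      have := Nat.mul_le_mul_left d.n this
      omega
    · intro s' _ hs'
      rw [hs', startIndex]
      congr 1
      ext r
      simp only [Finset.mem_filter, Finset.mem_range]
      constructor
      · rintro ⟨-, h⟩
        exact h
      · rintro h
        exact ⟨(mem_others.1 h.1).1, h⟩

/-- Write the rotated order into the array `2`. -/
def orderProg : Program :=
  .seq (.forLoop 9 (.var 5) (.ite (.natLe (.var 5) (.add (.var 8) (.var 9)))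
      (.storeNat 2 (.var 9) (.get 1 (.sub (.add (.var 8) (.var 9)) (.var 5))))
      (.storeNat 2 (.var 9) (.get 1 (.add (.var 8) (.var 9))))))
    (.storeNat 2 (.var 5) (.var 2))

theorem runs_orderProg {W L k p : ℕ} {s : Mem} (h5 : s.var 5 = L) (h8 : s.var 8 = k)
    (h2 : s.var 2 = p) (hk : k ≤ L) (hLW : L ≤ W) (hpW : p ≤ W) (hxW : ∀ i < L, s.arr 1 i ≤ W) :
    Runs W orderProg s (40 * L + 40)
      (fun s' => ∀ j < L + 1, s'.arr 2 j = pointOrder L k (s.arr 1) p j) := by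
  refine Runs.seq_mid (40 * L + 20) 4 (by omega)
    (R := fun s' => ∀ j < L, s'.arr 2 j = rotate L k (s.arr 1) j) ?_ ?_
  · refine Runs.forLoop L 20 (fun i s' => ∀ j < i, s'.arr 2 j = rotate L k (s.arr 1) j) hLW
      (by simp only [NatExpr.cost]; omega) (by simp) ?_ ?_ (fun s' h _ _ => h)
    · intro i s' _ _ _ hs'
      simpa [h5] using hs'.var 5 (by decide)
    · intro i s' hi hI hxi hs'
      have h5' : s'.var 5 = L := by simpa [h5] using hs'.var 5 (by decide)
      have h8' : s'.var 8 = k := by simpa [h8] using hs'.var 8 (by decide)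
      have h1' : s'.arr 1 = s.arr 1 := hs'.arr 1 (by decide)
      refine Runs.ite 12 (by simp [Test.cost, NatExpr.cost]) (fun h => ?_) (fun h => ?_)
      · simp [h5', h8', hxi] at h
        refine Runs.storeNat (by simp; omega) ?_ (by simp [NatExpr.cost]) ?_
        · simpa [h1', h5', h8', hxi] using hxW _ (by omega)
        · refine ⟨by simpa using hxi, fun j hj => ?_⟩
          rcases Nat.lt_succ_iff_lt_or_eq.1 hj with hj | rfl
          · simpa [hxi, hj.ne] using hI j hj
          · simp [hxi, h1', h5', h8', rotate, h.not_gt]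
      · simp [h5', h8', hxi] at h
        refine Runs.storeNat (by simp; omega) ?_ (by simp [NatExpr.cost]) ?_
        · simpa [h1', h5', h8', hxi] using hxW _ (by omega)
        · refine ⟨by simpa using hxi, fun j hj => ?_⟩
          rcases Nat.lt_succ_iff_lt_or_eq.1 hj with hj | rfl
          · simpa [hxi, hj.ne] using hI j hj
          · simp [hxi, h1', h8', rotate, h]
  · intro s' hs' h
    have h5' : s'.var 5 = L := by simpa [h5] using hs'.var 5 (by decide)
    have h2' : s'.var 2 = p := by simpa [h2] using hs'.var 2 (by decide)
    refine Runs.storeNat (by simpa [h5'] using hLW) (by simpa [h2'] using hpW)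
      (by simp [NatExpr.cost]) fun j hj => ?_
    rcases Nat.lt_succ_iff_lt_or_eq.1 hj with hj | rfl
    · simpa [h5', hj.ne, pointOrder, hj] using h j hj
    · simp [h5', h2', pointOrder]

/-! ### Dynamic programming over intervals -/

open Classical in
/-- The start of the longest interval that ends before `j` and is covered by `h`. -/
noncomputable def runStart (cov : ℕ → ℕ → Prop) : ℕ → ℕ → ℕ
  | 0, _ => 0
  | j + 1, h => if cov j h then runStart cov j h else j + 1

theorem runStart_le (cov : ℕ → ℕ → Prop) (j h : ℕ) : runStart cov j h ≤ j := by
  induction j with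
  | zero => simp [runStart]
  | succ j ih =>
    simp only [runStart]
    split_ifs <;> omega

theorem cov_of_runStart_le {cov : ℕ → ℕ → Prop} {j h l : ℕ} (hl : runStart cov j h ≤ l)
    (hlj : l < j) : cov l h := by
  induction j with
  | zero => omega
  | succ j ih =>
    simp only [runStart] at hl
    split_ifs at hl with hc
    · rcases Nat.lt_succ_iff_lt_or_eq.1 hlj with hlt | rfl
      · exact ih hl hlt
      · exact hc
    · omega

theorem runStart_le_of_cov {cov : ℕ → ℕ → Prop} {i j h : ℕ} (hij : i ≤ j)
    (hc : ∀ l, i ≤ l → l < j → cov l h) : runStart cov j h ≤ i := by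
  induction j with
  | zero => simp [runStart]
  | succ j ih =>
    rcases hij.eq_or_lt with rfl | hlt
    · exact runStart_le _ _ _
    · simp only [runStart]
      rw [if_pos (hc j (by omega) (by omega))]
      exact ih (by omega) fun l hl hlj => hc l hl (by omega)

/-- The first `N` rows of a table of minimum weights of chains: `par` and `start` hold the last set
of an optimal chain (plus one) and the start of its interval. -/
structure ChainTable (cov : ℕ → ℕ → Prop) (w : ℕ → ℝ) (m N : ℕ) (D : ℕ → ℝ) (par start : ℕ → ℕ) :
    Prop where
  zero : D 0 = 0
  step : ∀ i < N, ∃ h < m, par (i + 1) = h + 1 ∧ cov i h ∧ start (i + 1) = runStart cov i h ∧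
    D (i + 1) = D (runStart cov i h) + w h
  le : ∀ i < N, ∀ h < m, cov i h → D (i + 1) ≤ D (runStart cov i h) + w h

namespace ChainTable

variable {cov : ℕ → ℕ → Prop} {w : ℕ → ℝ} {m N : ℕ} {D D' : ℕ → ℝ} {par start par' start' : ℕ → ℕ}

theorem congr (h : ChainTable cov w m N D par start) (hD : ∀ i ≤ N, D' i = D i)
    (hp : ∀ i ≤ N, par' i = par i) (hs : ∀ i ≤ N, start' i = start i) :
    ChainTable cov w m N D' par' start' where
  zero := by rw [hD 0 (by omega), h.zero]
  step i hi := by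
    obtain ⟨k, hk, h1, h2, h3, h4⟩ := h.step i hi
    have := runStart_le cov i k
    exact ⟨k, hk, by rw [hp _ (by omega), h1], h2, by rw [hs _ (by omega), h3],
      by rw [hD _ (by omega), hD _ (by omega), h4]⟩
  le i hi k hk hc := by
    have := runStart_le cov i k
    rw [hD _ (by omega), hD _ (by omega)]
    exact h.le i hi k hk hc

/-- Let `k` be the last set of an optimal chain for `j + 1`. If `k` also covers the position before
`j`, its interval can be shortened by one and gives a chain for `j` of the same weight; otherwise
the interval is the single position `j`, and dropping it saves `w k`. -/
theorem mono (h : ChainTable cov w m N D par start) (hw : ∀ h < m, 0 ≤ w h) {i j : ℕ}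
    (hij : i ≤ j) (hj : j ≤ N) : D i ≤ D j := by
  induction j, hij using Nat.le_induction with
  | base => exact le_rfl
  | succ j hij ih =>
    refine (ih (by omega)).trans ?_
    obtain ⟨k, hk, -, hc, -, h4⟩ := h.step j (by omega)
    rw [h4]
    cases j with
    | zero => simpa [runStart] using hw k hk
    | succ j =>
      simp only [runStart]
      split_ifs with hcj
      · exact h.le j (by omega) k hk hcj
      · linarith [hw k hk]

/-- Replacing the start of each interval by the leftmost possible one does not hurt, by monotonicity
of `D`; hence one candidate per set suffices in each row. -/
theorem le_of_chain (h : ChainTable cov w m N D par start) (hw : ∀ h < m, 0 ≤ w h) {j : ℕ} {c : ℝ}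
    (hc : Chain (fun j h => h < m ∧ cov j h) w j c) (hj : j ≤ N) : D j ≤ c := by
  induction hc with
  | nil => exact h.zero.le
  | @step i j k c hc hij hcov ih =>
    obtain ⟨j, rfl⟩ : ∃ j', j = j' + 1 := ⟨j - 1, by omega⟩
    have hk := (hcov i le_rfl hij).1
    have h1 := h.le j (by omega) k hk (hcov j (by omega) (by omega)).2
    have h2 : runStart cov j k ≤ i :=
      runStart_le_of_cov (by omega) fun l hl hlj => (hcov l hl (by omega)).2
    have h3 := h.mono hw h2 (by omega)
    have h4 := ih (by omega)
    linarith

end ChainTable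

/-- The table entries of the row `j + 1` after the sets `h' < h` have been considered. -/
structure ChainRow (cov : ℕ → ℕ → Prop) (w : ℕ → ℝ) (h j : ℕ) (D : ℕ → ℝ) (par start : ℕ → ℕ) :
    Prop where
  step : (par (j + 1) = 0 ∧ ∀ h' < h, ¬ cov j h') ∨ ∃ h' < h, par (j + 1) = h' + 1 ∧ cov j h' ∧
    start (j + 1) = runStart cov j h' ∧ D (j + 1) = D (runStart cov j h') + w h'
  le : ∀ h' < h, cov j h' → D (j + 1) ≤ D (runStart cov j h') + w h'

/-- The test whether the half-plane `var 10` contains the point at the position `var 9`. -/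
def coverTest : Test :=
  .realLe (.add (.mul (.get 2 (.var 10)) (.get 0 (.get 2 (.var 9))))
    (.mul (.get 3 (.var 10)) (.get 1 (.get 2 (.var 9))))) (.get 4 (.var 10))

/-- The weight of a chain whose last interval is the current one of the half-plane `var 10`. -/
def candidate : RealExpr := .add (.get 6 (.get 3 (.var 10))) (.get 5 (.var 10))

/-- The test whether the candidate improves the row `var 9 + 1`. -/
def improveTest : Test :=
  .disj (.natEq (.get 4 (.add (.var 9) (.const 1))) (.const 0))
    (.neg (.realLe (.get 6 (.add (.var 9) (.const 1))) candidate))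

/-- Consider the half-plane `var 10` for the row `var 9 + 1`. -/
def relaxProg : Program :=
  .ite coverTest
    (.ite improveTest
      (.seq (.storeNat 4 (.add (.var 9) (.const 1)) (.add (.var 10) (.const 1)))
        (.seq (.storeNat 5 (.add (.var 9) (.const 1)) (.get 3 (.var 10)))
          (.storeReal 6 (.add (.var 9) (.const 1)) candidate)))
      .skip)
    (.storeNat 3 (.var 10) (.add (.var 9) (.const 1)))

/-- Compute the table of minimum weights of chains for the order in the array `2`. -/
def tableProg : Program :=
  .seq (.forLoop 10 (.var 1) (.storeNat 3 (.var 10) (.const 0)))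
    (.seq (.storeReal 6 (.const 0) (.const 0))
      (.forLoop 9 (.add (.var 5) (.const 1))
        (.seq (.storeNat 4 (.add (.var 9) (.const 1)) (.const 0))
          (.forLoop 10 (.var 1) relaxProg))))

theorem coverTest_holds {d : IndexedInput} {s : Mem} (h : HasInput d s) :
    coverTest.Holds s ↔ d.In (s.arr 2 (s.var 9)) (s.var 10) := by
  simp [coverTest, h.a, h.b, h.c, h.X, h.Y, IndexedInput.In, InHalfPlane]

/-- The state of the computation of the row `j + 1` before the half-plane `h`. -/
structure RelaxInv (d : IndexedInput) (sq : ℕ → ℕ) (j h : ℕ) (s : Mem) : Prop where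
  table : ChainTable (fun j h => d.In (sq j) h) d.w d.m j (s.real 6) (s.arr 4) (s.arr 5)
  row : ChainRow (fun j h => d.In (sq j) h) d.w h j (s.real 6) (s.arr 4) (s.arr 5)
  run : ∀ h' < d.m, s.arr 3 h' =
    runStart (fun j h => d.In (sq j) h) (if h' < h then j + 1 else j) h'

/-- The array `3` is advanced in place: half-planes already treated hold their run start for `j +
1`, the others for `j`. Only a half-plane that misses the point needs a write, and this makes the
step take constant time. -/
theorem runs_relaxProg {W j h : ℕ} {d : IndexedInput} {sq : ℕ → ℕ} {s : Mem} (hin : HasInput d s)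
    (hs2 : s.arr 2 = sq) (h9 : s.var 9 = j) (h10 : s.var 10 = h) (hh : h < d.m) (hjW : j + 1 ≤ W)
    (hmW : d.m ≤ W) (hI : RelaxInv d sq j h s) :
    Runs W relaxProg s 100 (fun s' => RelaxInv d sq j (h + 1) s') := by
  set cov : ℕ → ℕ → Prop := fun j h => d.In (sq j) h with hcov
  have hct := coverTest_holds hin
  rw [hs2, h9, h10] at hct
  have hrun : s.arr 3 h = runStart cov j h := by simpa using hI.run h hh
  have hle := runStart_le cov j h
  have hcand : candidate.eval s = s.real 6 (runStart cov j h) + d.w h := by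
    simp [candidate, h10, hrun, hin.w]
  have himp : improveTest.Holds s ↔ s.arr 4 (j + 1) = 0 ∨
      s.real 6 (runStart cov j h) + d.w h < s.real 6 (j + 1) := by
    simp only [improveTest, Test.Holds, hcand]
    simp [h9]
  have hrun' : ∀ (f : ℕ → ℕ), d.In (sq j) h → f = s.arr 3 →
      ∀ h' < d.m, f h' = runStart cov (if h' < h + 1 then j + 1 else j) h' := by
    rintro f hc rfl h' hh'
    rw [hI.run h' hh']
    rcases lt_trichotomy h' h with hlt | rfl | hgt
    · simp [hlt, hlt.trans (Nat.lt_succ_self h), hcov]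
    · simp [runStart, hcov, hc]
    · simp [hcov, hgt.not_gt, show ¬ h' < h + 1 by omega]
  refine Runs.ite 80 (by decide) (fun hb => ?_) (fun hb => ?_)
  · have hc : cov j h := hct.1 hb
    refine Runs.ite 50 (by decide) (fun hb' => ?_) (fun hb' => ?_)
    · rw [himp] at hb'
      refine Runs.seq 10 40 (by norm_num) ?_
      refine Runs.storeNat (by simpa [h9] using hjW) (by simp [h10]; omega)
        (by simp [NatExpr.cost]) ?_
      refine Runs.seq 10 30 (by norm_num) ?_
      refine Runs.storeNat (by simpa [h9] using hjW) (by simp [h10, hrun]; omega)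
        (by simp [NatExpr.cost]) ?_
      refine Runs.storeReal (by simpa [h9] using hjW) (by decide) ?_
      have hcand' : ∀ i v i' v', candidate.eval ((s.setArr 4 i v).setArr 5 i' v') =
          s.real 6 (runStart cov j h) + d.w h := fun i v i' v' => by
        rw [← hcand]; simp [candidate]
      rw [hcand']
      refine ⟨?_, ⟨.inr ⟨h, by omega, ?_⟩, fun h' hh' hc' => ?_⟩, ?_⟩
      · refine hI.table.congr ?_ ?_ ?_ <;> intro i hi <;>
          simp [h9, show i ≠ j + 1 by omega]
      · have : runStart cov j h ≠ j + 1 := by omega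
        refine ⟨by simp [h9, h10], hc, by simp [h9, h10, hrun, hcov], ?_⟩
        simp [h9, this, ← hcov]
      · have h1 := runStart_le cov j h'
        have h2 : runStart cov j h' ≠ j + 1 := by omega
        simp only [Mem.setReal_real, Mem.setArr_real, if_true, NatExpr.eval, Mem.setArr_var, h9,
          Function.update_self, Function.update_of_ne h2, ← hcov]
        rcases Nat.lt_succ_iff_lt_or_eq.1 hh' with hlt | rfl
        · have h3 := hI.row.le h' hlt hc'
          rcases hb' with h0 | h0
          · rcases hI.row.step with ⟨-, hno⟩ | ⟨k, -, hk, -⟩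
            · exact absurd hc' (hno h' hlt)
            · omega
          · exact h0.le.trans h3
        · exact le_rfl
      · exact hrun' _ hc (by simp)
    · rw [himp] at hb'
      push Not at hb'
      refine Runs.skip (by norm_num) ⟨hI.table, ⟨?_, fun h' hh' hc' => ?_⟩, hrun' _ hc rfl⟩
      · rcases hI.row.step with ⟨h0, -⟩ | ⟨k, hk, hk'⟩
        · exact absurd h0 hb'.1
        · exact .inr ⟨k, by omega, hk'⟩
      · rcases Nat.lt_succ_iff_lt_or_eq.1 hh' with hlt | rfl
        · exact hI.row.le h' hlt hc'
        · exact hb'.2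
  · have hc : ¬ cov j h := hct.not.1 hb
    refine Runs.storeNat (by simp [h10]; omega) (by simpa [h9] using hjW)
      (by simp [NatExpr.cost]) ⟨?_, ⟨?_, fun h' hh' hc' => ?_⟩, fun h' hh' => ?_⟩
    · simpa using hI.table
    · simp only [Mem.setArr_real, Mem.setArr_arr]
      rcases hI.row.step with ⟨h0, hno⟩ | ⟨k, hk, hk'⟩
      · refine .inl ⟨h0, fun h' hh' => ?_⟩
        rcases Nat.lt_succ_iff_lt_or_eq.1 hh' with hlt | rfl
        · exact hno h' hlt
        · exact hc
      · exact .inr ⟨k, by omega, hk'⟩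
    · rcases Nat.lt_succ_iff_lt_or_eq.1 hh' with hlt | rfl
      · exact hI.row.le h' hlt hc'
      · exact absurd hc' hc
    · simp only [Mem.setArr_arr, if_true, NatExpr.eval, h9, h10]
      rcases lt_trichotomy h' h with hlt | rfl | hgt
      · rw [Function.update_of_ne hlt.ne, hI.run h' hh']
        simp [hlt, hlt.trans (Nat.lt_succ_self h)]
      · have : ¬ d.In (sq j) h' := hc
        simp [runStart, this]
      · rw [Function.update_of_ne hgt.ne', hI.run h' hh']
        simp [hgt.not_gt, show ¬ h' < h + 1 by omega]

theorem runs_tableProg {W L : ℕ} {d : IndexedInput} {s : Mem} (hin : HasInput d s)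
    (h5 : s.var 5 = L) (hLW : L + 1 ≤ W) (hmW : d.m ≤ W)
    (hcov : ∀ j < L + 1, ∃ h < d.m, d.In (s.arr 2 j) h) :
    Runs W tableProg s ((L + 1) * (110 * d.m + 60) + 20 * d.m + 60) (fun s' =>
      ChainTable (fun j h => d.In (s.arr 2 j) h) d.w d.m (L + 1) (s'.real 6) (s'.arr 4)
        (s'.arr 5)) := by
  set sq := s.arr 2 with hsq
  refine Runs.seq_mid (20 * d.m + 20) ((L + 1) * (110 * d.m + 60) + 40) (by omega)
    (R := fun s' => ∀ h < d.m, s'.arr 3 h = 0) ?_ ?_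
  · refine Runs.forLoop d.m 10 (fun i s' => ∀ h < i, s'.arr 3 h = 0) hmW
      (by simp only [NatExpr.cost]; omega) (by simp) ?_ ?_ (fun s' h _ _ => h)
    · intro i s' _ _ _ hs'
      exact (hin.same hs' (by decide) (by decide)).m
    · intro i s' hi hI hxi hs'
      refine Runs.storeNat (by simp [hxi]; omega) (by simp) (by simp [NatExpr.cost])
        ⟨by simpa using hxi, fun h hh => ?_⟩
      rcases Nat.lt_succ_iff_lt_or_eq.1 hh with hlt | rfl
      · simpa [hxi, hlt.ne] using hI h hlt
      · simp [hxi]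
  intro s₁ hs₁ hz
  refine Runs.seq_mid 10 ((L + 1) * (110 * d.m + 60) + 20) (by omega)
    (R := fun s' => s'.real 6 0 = 0 ∧ s'.arr 3 = s₁.arr 3)
    (Runs.storeReal (by simp) (by decide) (by simp)) ?_
  rintro s₂ hs₂ ⟨hr, ha⟩
  have hsame₂ : Same tableProg s s₂ := hs₁.seq_left.trans (hs₂.seq_left.seq_right)
  refine Runs.forLoop (L + 1) (110 * d.m + 40)
    (fun j s' => ChainTable (fun j h => d.In (sq j) h) d.w d.m j (s'.real 6) (s'.arr 4) (s'.arr 5) ∧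
      ∀ h < d.m, s'.arr 3 h = runStart (fun j h => d.In (sq j) h) j h) hLW ?_ ?_ ?_ ?_ ?_
  · simp only [NatExpr.cost]
    have : 1 + 1 + 1 + (110 * d.m + 40) + 8 ≤ 110 * d.m + 60 := by omega
    have := Nat.mul_le_mul_left (L + 1) this
    linarith
  · refine ⟨⟨by simpa using hr, by simp, by simp⟩, fun h hh => ?_⟩
    simp [ha, hz h hh, runStart]
  · intro i s' _ _ _ hs'
    have := (hsame₂.trans (hs'.seq_right.seq_right)).var 5 (by decide)
    simp [this, h5]
  · rintro j s₃ hj ⟨hT, hR⟩ h9 hs₃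
    have hsame₃ := hsame₂.trans (hs₃.seq_right.seq_right)
    have hin₃ := hin.same hsame₃ (by decide) (by decide)
    have hsq₃ : s₃.arr 2 = sq := hsame₃.arr 2 (by decide)
    refine Runs.seq_mid 10 (110 * d.m + 20) (by omega)
      (R := fun s' => RelaxInv d sq j 0 s' ∧ s'.var 9 = j) ?_ ?_
    · refine Runs.storeNat (by simp [h9]; omega) (by simp) (by simp [NatExpr.cost])
        ⟨⟨?_, ⟨.inl ⟨?_, by simp⟩, by simp⟩, ?_⟩, by simpa using h9⟩
      · refine hT.congr ?_ ?_ ?_ <;> intro i hi <;> simp [h9, show i ≠ j + 1 by omega]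
      · simp [h9]
      · simpa using hR
    rintro s₄ hs₄ ⟨hI₄, h94⟩
    have hin₄ := hin₃.same hs₄ (by decide) (by decide)
    have hsq₄ : s₄.arr 2 = sq := (hs₄.arr 2 (by decide)).trans hsq₃
    refine Runs.forLoop d.m 100 (fun h s' => RelaxInv d sq j h s') hmW ?_ ?_ ?_ ?_ ?_
    · simp only [NatExpr.cost]; omega
    · exact ⟨by simpa using hI₄.table, ⟨by simpa using hI₄.row.step, by simp⟩,
        by simpa using hI₄.run⟩
    · intro i s' _ _ _ hs'
      exact (hin₄.same hs' (by decide) (by decide)).m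
    · intro h s₅ hh hI h10 hs₅
      refine (runs_relaxProg (hin₄.same hs₅ (by decide) (by decide))
        ((hs₅.arr 2 (by decide)).trans hsq₄) ((hs₅.var 9 (by decide)).trans h94) h10 hh
        (by omega) hmW hI).mono le_rfl fun s' hs' hI' => ⟨?_, ?_⟩
      · exact (hs'.var 10 (by decide)).trans h10
      · exact ⟨by simpa using hI'.table, ⟨by simpa using hI'.row.step,
          by simpa using hI'.row.le⟩, by simpa using hI'.run⟩
    · intro s₅ hI h10 hs₅
      have h95 : s₅.var 9 = j := (hs₅.var 9 (by decide)).trans h94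
      refine ⟨h95, ⟨by simpa using hI.table.zero, fun i hi => ?_, fun i hi h hh hc => ?_⟩, ?_⟩
      · simp only [Mem.setVar_arr, Mem.setVar_real]
        rcases Nat.lt_succ_iff_lt_or_eq.1 hi with hlt | rfl
        · exact hI.table.step i hlt
        -- The row cannot have remained empty, since some half-plane covers the point at this
        -- position.
        · rcases hI.row.step with ⟨-, hno⟩ | hex
          · obtain ⟨h, hh, hc⟩ := hcov i hj
            exact absurd hc (hno h hh)
          · exact hex
      · simp only [Mem.setVar_real]
        rcases Nat.lt_succ_iff_lt_or_eq.1 hi with hlt | rfl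
        · exact hI.table.le i hlt h hh hc
        · exact hI.row.le h hh hc
      · intro h hh
        simpa [hh] using hI.run h hh
  · rintro s' ⟨hT, -⟩ - -
    exact hT

/-! ### Recording the best solution -/

/-- The indices marked in the array `0`. -/
def marked (m : ℕ) (s : Mem) : Finset ℕ := (Finset.range m).filter fun h => s.arr 0 h = 1

/-- Mark the half-planes of the optimal chain in the array `0`. -/
def markProg : Program :=
  .seq (.forLoop 10 (.var 1) (.storeNat 0 (.var 10) (.const 0)))
    (.seq (.assign 13 (.add (.var 5) (.const 1)))
      (.forLoop 9 (.add (.var 5) (.const 1))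
        (.ite (.natEq (.var 13) (.const 0)) .skip
          (.seq (.storeNat 0 (.sub (.get 4 (.var 13)) (.const 1)) (.const 1))
            (.assign 13 (.get 5 (.var 13)))))))

/-- Backtracking along `start`: the positions from `var 13` on are covered by the marked sets, whose
weight plus the table entry at `var 13` never exceeds the final entry. -/
theorem runs_markProg {W L : ℕ} {d : IndexedInput} {cov : ℕ → ℕ → Prop} {s : Mem}
    (hm : s.var 1 = d.m) (hw : ∀ h < d.m, 0 ≤ d.w h) (h5 : s.var 5 = L) (hLW : L + 1 ≤ W)
    (hmW : d.m ≤ W)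
    (hT : ChainTable cov d.w d.m (L + 1) (s.real 6) (s.arr 4) (s.arr 5)) :
    Runs W markProg s (20 * d.m + 50 * (L + 1) + 50) (fun s' =>
      (∀ j < L + 1, ∃ h ∈ marked d.m s', cov j h) ∧
      ∑ h ∈ marked d.m s', d.w h ≤ s.real 6 (L + 1)) := by
  refine Runs.seq_mid (20 * d.m + 20) (50 * (L + 1) + 30) (by omega)
    (R := fun s' => ∀ h < d.m, s'.arr 0 h = 0) ?_ ?_
  · refine Runs.forLoop d.m 10 (fun i s' => ∀ h < i, s'.arr 0 h = 0) hmW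
      (by simp only [NatExpr.cost]; omega) (by simp) ?_ ?_ (fun s' h _ _ => h)
    · intro i s' _ _ _ hs'
      simpa [hm] using hs'.var 1 (by decide)
    · intro i s' hi hI hxi hs'
      refine Runs.storeNat (by simp [hxi]; omega) (by simp) (by simp [NatExpr.cost])
        ⟨by simpa using hxi, fun h hh => ?_⟩
      rcases Nat.lt_succ_iff_lt_or_eq.1 hh with hlt | rfl
      · simpa [hxi, hlt.ne] using hI h hlt
      · simp [hxi]
  intro s₁ hs₁ hz
  have h51 : s₁.var 5 = L := (hs₁.var 5 (by decide)).trans h5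
  refine Runs.seq_mid 10 (50 * (L + 1) + 20) (by omega)
    (R := fun s' => s'.var 13 = L + 1 ∧ s'.arr 0 = s₁.arr 0)
    (Runs.assign (by simpa [h51] using hLW) (by simp [NatExpr.cost]) (by simp [h51])) ?_
  rintro s₂ hs₂ ⟨h13, ha⟩
  have hsame₂ : Same markProg s s₂ := hs₁.seq_left.trans (hs₂.seq_left.seq_right)
  -- The number of intervals is unknown, so the loop runs `L + 1` rounds and idles once `var 13` is
  -- `0`; the first conjunct forces that value at the end.
  refine Runs.forLoop (L + 1) 30 (fun i s' => s'.var 13 + i ≤ L + 1 ∧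
    (∀ j < L + 1, s'.var 13 ≤ j → ∃ h ∈ marked d.m s', cov j h) ∧
    ∑ h ∈ marked d.m s', d.w h + s.real 6 (s'.var 13) ≤ s.real 6 (L + 1)) hLW ?_ ?_ ?_ ?_ ?_
  · simp only [NatExpr.cost]; omega
  · have : marked d.m (s₂.setVar 9 0) = ∅ := by
      refine Finset.filter_eq_empty_iff.2 fun h hh => ?_
      simp [ha, hz h (Finset.mem_range.1 hh)]
    rw [this]
    refine ⟨by simp [h13], fun j hj hj' => ?_, by simp [h13]⟩
    simp [h13] at hj'
    omega
  · intro i s' _ _ _ hs'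
    have := (hsame₂.trans (hs'.seq_right.seq_right)).var 5 (by decide)
    simp [this, h5]
  · rintro i s₃ hi ⟨hI1, hI2, hI3⟩ h9 hs₃
    have hsame₃ := hsame₂.trans (hs₃.seq_right.seq_right)
    have h4 : s₃.arr 4 = s.arr 4 := hsame₃.arr 4 (by decide)
    have h5' : s₃.arr 5 = s.arr 5 := hsame₃.arr 5 (by decide)
    have hmk : ∀ v, marked d.m (s₃.setVar 9 v) = marked d.m s₃ := fun v => rfl
    refine Runs.ite 20 (by decide) (fun h0 => ?_) (fun h0 => ?_)
    · simp at h0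
      refine Runs.skip (by norm_num) ⟨h9, ?_, ?_, ?_⟩
      · simp [h0]; omega
      · simpa [hmk] using hI2
      · simpa [hmk] using hI3
    · simp at h0
      obtain ⟨j, hj⟩ : ∃ j, s₃.var 13 = j + 1 := ⟨s₃.var 13 - 1, by omega⟩
      obtain ⟨h, hh, hp, hc, hst, hD⟩ := hT.step j (by omega)
      have hle := runStart_le cov j h
      refine Runs.seq 10 10 (by norm_num) ?_
      refine Runs.storeNat (by simp [h4, hj, hp]; omega) (by simp; omega)
        (by simp [NatExpr.cost]) ?_
      refine Runs.assign (by simp [h5', hj, hst]; omega) (by simp [NatExpr.cost]) ?_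
      set s₄ := ((s₃.setArr 0 (NatExpr.eval s₃ ((NatExpr.get 4 (.var 13)).sub (.const 1)))
        (NatExpr.eval s₃ (.const 1))).setVar 13 _) with hs₄
      have h13' : s₄.var 13 = runStart cov j h := by simp [hs₄, h5', hj, hst]
      have hins : marked d.m (s₄.setVar 9 (i + 1)) = insert h (marked d.m s₃) := by
        ext h'
        by_cases he : h' = h
        · subst he
          simp [marked, hs₄, h4, hj, hp, hh]
        · simp [marked, hs₄, h4, hj, hp, he]
      refine ⟨by simpa [hs₄] using h9, ?_, ?_, ?_⟩
      · simp [h13']; omega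
      · rw [hins]
        intro l hl hl'
        simp only [Mem.setVar_var, h13'] at hl'
        norm_num at hl'
        by_cases hlj : l < j + 1
        · refine ⟨h, Finset.mem_insert_self _ _, ?_⟩
          rcases Nat.lt_succ_iff_lt_or_eq.1 hlj with hlt | rfl
          · exact cov_of_runStart_le hl' hlt
          · exact hc
        · obtain ⟨h', hh', hc'⟩ := hI2 l hl (by omega)
          exact ⟨h', Finset.mem_insert_of_mem hh', hc'⟩
      · rw [hins]
        -- Only an inequality: a chain may use a half-plane several times, while the marked set
        -- counts it once.
        have h1 : ∑ h' ∈ insert h (marked d.m s₃), d.w h' ≤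
            ∑ h' ∈ marked d.m s₃, d.w h' + d.w h := by
          by_cases hmem : h ∈ marked d.m s₃
          · rw [Finset.insert_eq_of_mem hmem]
            linarith [hw h hh]
          · rw [Finset.sum_insert hmem]
            linarith
        have h2 : (s₄.setVar 9 (i + 1)).var 13 = runStart cov j h := by simp [h13']
        rw [h2]
        rw [hj, hD] at hI3
        linarith
  · rintro s' ⟨h1, h2, h3⟩ - -
    have h0 : s'.var 13 = 0 := by omega
    rw [h0, hT.zero] at h3
    exact ⟨fun j hj => h2 j hj (by omega), by linarith⟩

/-- Keep the optimal chain if it is lighter than the best solution so far. -/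
def recordProg : Program :=
  .ite (.disj (.natEq (.var 12) (.const 0))
      (.neg (.realLe (.get 7 (.const 0)) (.get 6 (.add (.var 5) (.const 1))))))
    (.seq (.assign 12 (.const 1))
      (.seq (.storeReal 7 (.const 0) (.get 6 (.add (.var 5) (.const 1)))) markProg))
    .skip

/-- The recorded solution, if there is one, is a coverage of weight at most `real 7 0`. -/
def Recorded (d : IndexedInput) (s : Mem) : Prop :=
  s.var 12 = 0 ∨ (CoversIndices d.n d.In (marked d.m s) ∧
    ∑ h ∈ marked d.m s, d.w h ≤ s.real 7 0)

/-- There is a recorded solution of weight at most `z`. -/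
def BestLe (s : Mem) (z : ℝ) : Prop := s.var 12 ≠ 0 ∧ s.real 7 0 ≤ z

theorem runs_recordProg {W L : ℕ} {d : IndexedInput} {sq : ℕ → ℕ} {s : Mem}
    (hm : s.var 1 = d.m) (hw : ∀ h < d.m, 0 ≤ d.w h) (h5 : s.var 5 = L) (hLW : L + 1 ≤ W)
    (hmW : d.m ≤ W)
    (hT : ChainTable (fun j h => d.In (sq j) h) d.w d.m (L + 1) (s.real 6) (s.arr 4) (s.arr 5))
    (hsq : ∀ i < d.n, ∃ j < L + 1, ∀ h, d.In (sq j) h → d.In i h) (hR : Recorded d s) :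
    Runs W recordProg s (20 * d.m + 50 * (L + 1) + 100) (fun s' =>
      Recorded d s' ∧ (∀ z, BestLe s z → BestLe s' z) ∧ BestLe s' (s.real 6 (L + 1))) := by
  refine Runs.ite (20 * d.m + 50 * (L + 1) + 80) ?_ (fun hb => ?_) (fun hb => ?_)
  · simp [Test.cost, NatExpr.cost, RealExpr.cost]; omega
  · simp [h5] at hb
    refine Runs.seq 10 (20 * d.m + 50 * (L + 1) + 70) (by omega) ?_
    refine Runs.assign (by simp; omega) (by simp [NatExpr.cost]) ?_
    refine Runs.seq 10 (20 * d.m + 50 * (L + 1) + 60) (by omega) ?_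
    refine Runs.storeReal (by simp) (by decide) ?_
    refine (runs_markProg (d := d) (L := L) (cov := fun j h => d.In (sq j) h) (by simpa using hm)
      hw (by simpa using h5) hLW hmW (by simpa using hT)).mono (by omega) fun s' hs' hM => ?_
    obtain ⟨hM1, hM2⟩ := hM
    have h12 : s'.var 12 = 1 := by simpa using hs'.var 12 (by decide)
    have h7 : s'.real 7 0 = s.real 6 (L + 1) := by
      rw [hs'.real 7 (by decide)]; simp [h5]
    refine ⟨.inr ⟨fun i hi => ?_, ?_⟩, fun z hz => ⟨by omega, ?_⟩, by omega, h7.le⟩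
    · obtain ⟨j, hj, hc⟩ := hsq i hi
      obtain ⟨h, hh, hc'⟩ := hM1 j hj
      exact ⟨h, hh, hc h hc'⟩
    · rw [h7]
      simpa using hM2
    · rw [h7]
      rcases hb with hb | hb
      · exact absurd hb hz.1
      · exact hb.le.trans hz.2
  · simp [h5] at hb
    exact Runs.skip (by omega) ⟨hR, fun z hz => hz, hb.1, hb.2⟩

/-! ### The complete program -/

/-- The half-planes are nondegenerate, have positive weights, and cover all the points. -/
structure IndexedInput.Valid (d : IndexedInput) : Prop where
  nondegenerate : ∀ h < d.m, d.a h ≠ 0 ∨ d.b h ≠ 0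
  weight_pos : ∀ h < d.m, 0 < d.w h
  covers : ∀ i < d.n, ∃ h < d.m, d.In i h

/-- Process one rotation of the angular order around the point `var 2`. -/
def roundProg (mode : Bool) : Program :=
  .seq (startProg mode) (.seq orderProg (.seq tableProg recordProg))

/-- The number of rotations that are tried. -/
def roundsExpr : Bool → NatExpr
  | true => .add (.var 5) (.const 1)
  | false => .var 1

/-- Process the angular order around the point `var 2`. -/
def pointProg (mode : Bool) : Program :=
  .seq sortProg (.forLoop 7 (roundsExpr mode) (roundProg mode))

/-- Compute a minimum-weight coverage. -/
def coverageProg (mode : Bool) : Program := .forLoop 2 (.var 0) (pointProg mode)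

theorem Recorded.same {d : IndexedInput} {s s' : Mem} (h : Recorded d s)
    (h12 : s'.var 12 = s.var 12) (h0 : s'.arr 0 = s.arr 0) (h7 : s'.real 7 = s.real 7) :
    Recorded d s' := by
  have : marked d.m s' = marked d.m s := by simp [marked, h0]
  simpa [Recorded, this, h12, h7] using h

theorem BestLe.same {s s' : Mem} {z : ℝ} (h : BestLe s z)
    (h12 : s'.var 12 = s.var 12) (h7 : s'.real 7 = s.real 7) : BestLe s' z := by
  simpa [BestLe, h12, h7] using h

theorem card_others_lt {d : IndexedInput} {p : ℕ} (hp : p < d.n) : (d.others p).card < d.n := by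
  have : (d.others p) ⊂ Finset.range d.n :=
    (Finset.ssubset_iff_of_subset fun q hq => Finset.mem_range.2 (mem_others.1 hq).1).2
      ⟨p, Finset.mem_range.2 hp, by simp [mem_others]⟩
  simpa using Finset.card_lt_card this

theorem exists_rotate_eq {L k r : ℕ} (x : ℕ → ℕ) (hk : k ≤ L) (hr : r < L) :
    ∃ j < L, rotate L k x j = x r := by
  rcases Nat.lt_or_ge r k with h | h
  · refine ⟨r + L - k, by omega, ?_⟩
    rw [rotate, if_neg (by omega)]
    congr 1; omega
  · refine ⟨r - k, by omega, ?_⟩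
    rw [rotate, if_pos (by omega)]
    congr 1; omega

theorem startIndex_false_le (d : IndexedInput) (p i : ℕ) :
    startIndex d p i false ≤ (d.others p).card := by
  simpa [startIndex] using Finset.card_filter_le (d.others p) _

/-- Whatever the rotation, the recorded set stays a genuine coverage. Optimality is claimed only
against those `h` whose boundary yields the rotation being tried. -/
theorem runs_roundProg {W p i : ℕ} {d : IndexedInput} {s : Mem} (mode : Bool) (hd : d.Valid)
    (hin : HasInput d s) (hW : d.n + d.m + 2 ≤ W) (h2 : s.var 2 = p) (hp : p < d.n)
    (h5 : s.var 5 = (d.others p).card)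
    (hx : ∀ q ∈ d.others p, s.arr 1 (rank (d.ang p) (d.others p) q) = q) (h7 : s.var 7 = i)
    (hi : mode = true → i ≤ (d.others p).card) (him : mode = false → i < d.m)
    (hR : Recorded d s) :
    Runs W (roundProg mode) s (2000 * (d.n * d.m)) (fun s' =>
      Recorded d s' ∧ (∀ z, BestLe s z → BestLe s' z) ∧
      ∀ h < d.m, startIndex d p i mode = startIndex d p h false → ∀ z,
        CheapChain d.X d.Y d.a d.b d.c d.w d.n d.m p h z → BestLe s' z) := by
  set L := (d.others p).card with hL
  set x := s.arr 1 with hx1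
  have hLn : L < d.n := card_others_lt hp
  have hm : 0 < d.m := by
    obtain ⟨h, hh, -⟩ := hd.covers p hp
    omega
  have hw : ∀ h < d.m, 0 ≤ d.w h := fun h hh => (hd.weight_pos h hh).le
  have hxmem : ∀ j < L, x j ∈ d.others p := fun j hj => mem_of_rank hx hj
  set k := startIndex d p i mode with hk
  have hkL : k ≤ L := by
    cases mode with
    | true => exact hi rfl
    | false => exact startIndex_false_le d p i
  have hsqn : ∀ j < L + 1, pointOrder L k x p j < d.n := by
    intro j hj
    simp only [pointOrder, rotate]
    split_ifs with h1 h3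
    · exact (mem_others.1 (hxmem _ h3)).1
    · exact (mem_others.1 (hxmem _ (by omega))).1
    · exact hp
  -- Everything is charged to `n * m`, as `L + 1 ≤ n` and both `n` and `m` are positive here.
  have htime : (1000 * d.n + 20) + ((40 * L + 40) + (((L + 1) * (110 * d.m + 60) + 20 * d.m + 60)
      + (20 * d.m + 50 * (L + 1) + 100))) ≤ 2000 * (d.n * d.m) := by
    have h1 : (L + 1) * (110 * d.m + 60) ≤ d.n * (110 * d.m + 60) := Nat.mul_le_mul_right _ hLn
    have h2 : d.n ≤ d.n * d.m := Nat.le_mul_of_pos_right _ hm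
    have h3 : d.m ≤ d.n * d.m := Nat.le_mul_of_pos_left _ (by omega)
    have h4 : d.n * (110 * d.m + 60) = 110 * (d.n * d.m) + 60 * d.n := by ring
    omega
  refine Runs.seq_mid _ _ htime (runs_startProg mode hin (by omega)
    (fun h => by have := hi h; omega) fun h => hd.nondegenerate _ (by rw [h7]; exact him h)) ?_
  intro s₁ hs₁ h8
  rw [h2, h7, ← hk] at h8
  have e₁ : s₁.var 12 = s.var 12 ∧ s₁.arr 0 = s.arr 0 ∧ s₁.real 7 = s.real 7 ∧ s₁.var 2 = p ∧
      s₁.var 5 = L ∧ s₁.arr 1 = x := by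
    cases mode <;> exact ⟨hs₁.var 12 (by decide), hs₁.arr 0 (by decide), hs₁.real 7 (by decide),
      (hs₁.var 2 (by decide)).trans h2, (hs₁.var 5 (by decide)).trans h5, hs₁.arr 1 (by decide)⟩
  have hin₁ : HasInput d s₁ := by
    cases mode <;> exact hin.same hs₁ (by decide) (by decide)
  obtain ⟨e12, e0, e7, e2, e5, e1⟩ := e₁
  refine Runs.seq_mid _ _ le_rfl (runs_orderProg e5 h8 e2 hkL (by omega) (by omega)
    fun j hj => by rw [e1]; have := (mem_others.1 (hxmem j hj)).1; omega) ?_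
  intro s₂ hs₂ hsq
  rw [e1] at hsq
  have hin₂ : HasInput d s₂ := hin₁.same hs₂ (by decide) (by decide)
  have h5₂ : s₂.var 5 = L := (hs₂.var 5 (by decide)).trans e5
  refine Runs.seq_mid _ _ le_rfl (runs_tableProg hin₂ h5₂ (by omega) (by omega) fun j hj => by
    rw [hsq j hj]
    exact hd.covers _ (hsqn j hj)) ?_
  intro s₃ hs₃ hT
  have f12 : s₃.var 12 = s.var 12 :=
    (hs₃.var 12 (by decide)).trans ((hs₂.var 12 (by decide)).trans e12)
  have f0 : s₃.arr 0 = s.arr 0 := (hs₃.arr 0 (by decide)).trans ((hs₂.arr 0 (by decide)).trans e0)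
  have f7 : s₃.real 7 = s.real 7 :=
    (hs₃.real 7 (by decide)).trans ((hs₂.real 7 (by decide)).trans e7)
  refine (runs_recordProg (hin₂.same hs₃ (by decide) (by decide)).m hw
    ((hs₃.var 5 (by decide)).trans h5₂) (by omega) (by omega) hT ?_ (hR.same f12 f0 f7)).mono
    le_rfl ?_
  · intro i hi
    by_cases hiV : i ∈ d.others p
    · obtain ⟨j, hj, hjr⟩ := exists_rotate_eq x hkL (rank_lt_card (f := d.ang p) hiV)
      refine ⟨j, by omega, fun h hc => ?_⟩
      rw [hsq j (by omega), pointOrder, if_pos hj, hjr, hx i hiV] at hc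
      exact hc
    -- Copies of `p`, and `p` itself, are absent from the sorted list and represented by the last
    -- position.
    · refine ⟨L, by omega, fun h hc => ?_⟩
      rw [hsq L (by omega), pointOrder, if_neg (lt_irrefl _)] at hc
      have hne : ¬ (d.X i - d.X p ≠ 0 ∨ d.Y i - d.Y p ≠ 0) := fun h => hiV (mem_others.2 ⟨hi, h⟩)
      push Not at hne
      rw [sub_eq_zero, sub_eq_zero] at hne
      simpa [IndexedInput.In, InHalfPlane, hne.1, hne.2] using hc
  · rintro s' - ⟨g1, g2, g3⟩
    refine ⟨g1, fun z hz => g2 z (hz.same f12 f7), fun h hh heq z hz => ?_⟩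
    obtain ⟨cost, hcost, hch⟩ := hz L k x hkL (fun j hj => mem_others.1 (hxmem j hj))
      (fun i j hij hj => sorted_of_rank hx hij hj) (fun j hj => by
        rw [heq, startIndex]
        exact le_iff_of_rank hx _ hj)
    refine ⟨g3.1, g3.2.trans ((hT.le_of_chain hw (j := L + 1) ?_ le_rfl).trans hcost)⟩
    have hmono : ∀ {j c}, j ≤ L + 1 → Chain (fun j h => h < d.m ∧
        InHalfPlane d.X d.Y d.a d.b d.c (pointOrder L k x p j) h) d.w j c →
        Chain (fun j h => h < d.m ∧ d.In (s₂.arr 2 j) h) d.w j c := by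
      intro j c hj hc
      induction hc with
      | nil => exact .nil
      | step hc hij hcov ih =>
        refine .step (ih (by omega)) hij fun l hl hlj => ?_
        rw [hsq l (by omega)]
        exact hcov l hl hlj
    exact hmono le_rfl hch

/-- A bound for the number of rotations that are tried. -/
def maxRounds (d : IndexedInput) : Bool → ℕ
  | true => d.n
  | false => d.m

theorem runs_pointProg {W p : ℕ} {d : IndexedInput} {s : Mem} (mode : Bool) (hd : d.Valid)
    (hin : HasInput d s) (hW : d.n + d.m + 2 ≤ W) (h2 : s.var 2 = p) (hp : p < d.n)
    (hR : Recorded d s) :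
    Runs W (pointProg mode) s (3000 * (d.n * d.n) + 3000 * (maxRounds d mode * (d.n * d.m)))
      (fun s' => Recorded d s' ∧ (∀ z, BestLe s z → BestLe s' z) ∧ ∀ h < d.m, ∀ z,
        CheapChain d.X d.Y d.a d.b d.c d.w d.n d.m p h z → BestLe s' z) := by
  have hm : 0 < d.m := by
    obtain ⟨h, hh, -⟩ := hd.covers p hp
    omega
  have hLn := card_others_lt hp
  set N := match mode with
    | true => (d.others p).card + 1
    | false => d.m with hN
  have hNK : N ≤ maxRounds d mode := by
    cases mode with
    | true => exact hLn
    | false => exact le_rfl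
  have hNW : N ≤ W := by
    cases mode <;> simp only [hN] <;> omega
  have hcost : (roundsExpr mode).cost ≤ 3 := by cases mode <;> decide
  have htime : (d.n * (1000 * d.n + 1000) + 20) +
      (N * ((roundsExpr mode).cost + 2000 * (d.n * d.m) + 8) + (roundsExpr mode).cost + 6) ≤
      3000 * (d.n * d.n) + 3000 * (maxRounds d mode * (d.n * d.m)) := by
    have h1 : d.n ≤ d.n * d.n := Nat.le_mul_of_pos_right _ (by omega)
    have h2 : 1 ≤ d.n * d.m := Nat.mul_pos (by omega) hm
    have h3 : (roundsExpr mode).cost + 2000 * (d.n * d.m) + 8 ≤ 3000 * (d.n * d.m) := by omega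
    have h4 := Nat.mul_le_mul hNK h3
    have h5 : maxRounds d mode * (3000 * (d.n * d.m)) =
      3000 * (maxRounds d mode * (d.n * d.m)) := by ring
    have h6 : d.n * (1000 * d.n + 1000) = 1000 * (d.n * d.n) + 1000 * d.n := by ring
    omega
  refine Runs.seq_mid _ _ htime (runs_sortProg hin (by omega)) ?_
  rintro s₁ hs₁ ⟨h5, hx⟩
  rw [h2] at h5 hx
  have hin₁ : HasInput d s₁ := hin.same hs₁ (by decide) (by decide)
  have h2₁ : s₁.var 2 = p := (hs₁.var 2 (by decide)).trans h2
  have hR₁ : Recorded d s₁ :=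
    hR.same (hs₁.var 12 (by decide)) (hs₁.arr 0 (by decide)) (hs₁.real 7 (by decide))
  have hB₁ : ∀ z, BestLe s z → BestLe s₁ z := fun z hz =>
    hz.same (hs₁.var 12 (by decide)) (hs₁.real 7 (by decide))
  have hframe : ∀ s', Same (.forLoop 7 (roundsExpr mode) (roundProg mode)) s₁ s' →
      HasInput d s' ∧ s'.var 2 = p ∧ s'.var 5 = (d.others p).card ∧ s'.arr 1 = s₁.arr 1 := by
    intro s' hs'
    cases mode <;> exact ⟨hin₁.same hs' (by decide) (by decide),
      (hs'.var 2 (by decide)).trans h2₁, (hs'.var 5 (by decide)).trans h5, hs'.arr 1 (by decide)⟩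
  refine Runs.forLoop N (2000 * (d.n * d.m)) (fun i s' => Recorded d s' ∧
    (∀ z, BestLe s z → BestLe s' z) ∧ ∀ i' < i, ∀ h < d.m,
      startIndex d p i' mode = startIndex d p h false → ∀ z,
        CheapChain d.X d.Y d.a d.b d.c d.w d.n d.m p h z → BestLe s' z) hNW le_rfl ?_ ?_ ?_ ?_
  · exact ⟨hR₁.same rfl rfl rfl, fun z hz => (hB₁ z hz).same rfl rfl, by simp⟩
  · intro i s' _ _ _ hs'
    obtain ⟨k1, -, k2, -⟩ := hframe s' hs'
    cases mode with
    | true => simp [roundsExpr, k2, hN]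
    | false => simp [roundsExpr, k1.m, hN]
  · rintro i s₂ hi ⟨hI1, hI2, hI3⟩ h7 hs₂
    obtain ⟨k1, k2, k3, k4⟩ := hframe s₂ hs₂
    refine (runs_roundProg mode hd k1 hW k2 hp k3 (by rwa [k4]) h7 ?_ ?_ hI1).mono le_rfl ?_
    · rintro rfl
      simp only [hN] at hi
      omega
    · rintro rfl
      simpa only [hN] using hi
    · rintro s₃ hs₃ ⟨g1, g2, g3⟩
      refine ⟨?_, g1.same rfl rfl rfl, fun z hz => (g2 z (hI2 z hz)).same rfl rfl,
        fun i' hi' h hh heq z hz => ?_⟩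
      · cases mode <;> exact (hs₃.var 7 (by decide)).trans h7
      · rcases Nat.lt_succ_iff_lt_or_eq.1 hi' with hlt | rfl
        · exact (g2 z (hI3 i' hlt h hh heq z hz)).same rfl rfl
        · exact (g3 h hh heq z hz).same rfl rfl
  · rintro s' ⟨hI1, hI2, hI3⟩ - -
    refine ⟨hI1, hI2, fun h hh z hz => ?_⟩
    cases mode with
    | true =>
      -- All starts from `0` to the number of other points were tried, so the one belonging to `h`
      -- is among them.
      exact hI3 (startIndex d p h false) (Nat.lt_succ_of_le (startIndex_false_le d p h)) h hh rfl
        z hz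
    | false => exact hI3 h hh h hh rfl z hz

theorem runs_coverageProg {W : ℕ} {d : IndexedInput} {s : Mem} (mode : Bool) (hd : d.Valid)
    (hin : HasInput d s) (hW : d.n + d.m + 2 ≤ W) (h12 : s.var 12 = 0)
    (h0 : ∀ i, s.arr 0 i = 0) :
    Runs W (coverageProg mode) s
      (4000 * d.n ^ 3 + 4000 * (maxRounds d mode * (d.n ^ 2 * d.m)) + 7) (fun s' =>
      CoversIndices d.n d.In (marked d.m s') ∧ ∀ T ⊆ Finset.range d.m, CoversIndices d.n d.In T →
        ∑ h ∈ marked d.m s', d.w h ≤ ∑ h ∈ T, d.w h) := by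
  have hframe : ∀ s', Same (coverageProg mode) s s' → HasInput d s' := by
    intro s' hs'
    cases mode <;> exact hin.same hs' (by decide) (by decide)
  have hempty : marked d.m s = ∅ := Finset.filter_eq_empty_iff.2 fun h _ => by simp [h0]
  refine Runs.forLoop d.n
    (3000 * (d.n * d.n) + 3000 * (maxRounds d mode * (d.n * d.m))) (fun p s' => Recorded d s' ∧
      (d.n = 0 → marked d.m s' = ∅) ∧ ∀ p' < p, ∀ h < d.m, ∀ z,
        CheapChain d.X d.Y d.a d.b d.c d.w d.n d.m p' h z → BestLe s' z) (by omega) ?_ ?_ ?_ ?_ ?_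
  · have h1 : d.n * (1 + (3000 * (d.n * d.n) + 3000 * (maxRounds d mode * (d.n * d.m))) + 8) =
      9 * d.n + 3000 * d.n ^ 3 + 3000 * (maxRounds d mode * (d.n ^ 2 * d.m)) := by ring
    have h2 : d.n ≤ d.n ^ 3 := Nat.le_self_pow (by norm_num) _
    simp only [NatExpr.cost]
    omega
  · exact ⟨.inl (by simpa using h12), fun _ => hempty, by simp⟩
  · intro i s' _ _ _ hs'
    exact (hframe s' hs').n
  · rintro p s₁ hp ⟨hI1, hI2, hI3⟩ h2 hs₁
    refine (runs_pointProg mode hd (hframe s₁ hs₁) hW h2 hp hI1).mono le_rfl ?_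
    rintro s₂ hs₂ ⟨g1, g2, g3⟩
    refine ⟨?_, g1.same rfl rfl rfl, fun h => by omega, fun p' hp' h hh z hz => ?_⟩
    · cases mode <;> exact (hs₂.var 2 (by decide)).trans h2
    · rcases Nat.lt_succ_iff_lt_or_eq.1 hp' with hlt | rfl
      · exact (g2 z (hI3 p' hlt h hh z hz)).same rfl rfl
      · exact (g3 h hh z hz).same rfl rfl
  · rintro s' ⟨hI1, hI2, hI3⟩ - -
    -- Without points no round takes place and the output array keeps its initial zeros; the empty
    -- set is optimal because weights are positive.
    rcases Nat.eq_zero_or_pos d.n with hn | hn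
    · rw [hI2 hn]
      refine ⟨fun i hi => by omega, fun T hT _ => ?_⟩
      rw [Finset.sum_empty]
      exact Finset.sum_nonneg fun h hh => (hd.weight_pos h (Finset.mem_range.1 (hT hh))).le
    · have key : ∀ T ⊆ Finset.range d.m, CoversIndices d.n d.In T →
          BestLe s' (∑ h ∈ T, d.w h) := by
        intro T hTm hT
        obtain ⟨p, hp, h, hh, hz⟩ := exists_cheapChain hn hd.nondegenerate hd.weight_pos hTm hT
        exact hI3 p hp h hh _ hz
      have hall := key (Finset.range d.m) subset_rfl fun i hi => by
        obtain ⟨h, hh, hc⟩ := hd.covers i hi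
        exact ⟨h, Finset.mem_range.2 hh, hc⟩
      rcases hI1 with h | ⟨h1, h2⟩
      · exact absurd h hall.1
      · exact ⟨h1, fun T hTm hT => h2.trans (key T hTm hT).2⟩

/-! ### From sequences to families -/

/-- The input given by finite families of points and half-planes. -/
noncomputable def IndexedInput.ofFamilies {n m : ℕ} (P : Fin n → ℝ × ℝ)
    (S : Fin m → WeightedHalfPlane) : IndexedInput where
  n := n
  m := m
  X := (inputMem P S).real 0
  Y := (inputMem P S).real 1
  a := (inputMem P S).real 2
  b := (inputMem P S).real 3
  c := (inputMem P S).real 4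
  w := (inputMem P S).real 5

theorem hasInput_inputMem {n m : ℕ} (P : Fin n → ℝ × ℝ) (S : Fin m → WeightedHalfPlane) :
    HasInput (.ofFamilies P S) (inputMem P S) :=
  ⟨rfl, rfl, rfl, rfl, rfl, rfl, rfl, rfl⟩

theorem ofFamilies_in {n m : ℕ} (P : Fin n → ℝ × ℝ) (S : Fin m → WeightedHalfPlane) (i : Fin n)
    (h : Fin m) : (IndexedInput.ofFamilies P S).In i h ↔ P i ∈ (S h).region := by
  simp [IndexedInput.In, IndexedInput.ofFamilies, InHalfPlane, inputMem, WeightedHalfPlane.region]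

theorem ofFamilies_w {n m : ℕ} (P : Fin n → ℝ × ℝ) (S : Fin m → WeightedHalfPlane) (h : Fin m) :
    (IndexedInput.ofFamilies P S).w h = (S h).weight := by
  simp [IndexedInput.ofFamilies, inputMem]

theorem ofFamilies_valid {n m : ℕ} {P : Fin n → ℝ × ℝ} {S : Fin m → WeightedHalfPlane}
    (hc : Covers P S Finset.univ) : (IndexedInput.ofFamilies P S).Valid where
  nondegenerate h (hh : h < m) := by
    simpa [IndexedInput.ofFamilies, inputMem, hh] using (S ⟨h, hh⟩).nondegenerate
  weight_pos h (hh : h < m) := by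
    simpa [IndexedInput.ofFamilies, inputMem, hh] using (S ⟨h, hh⟩).weight_pos
  covers i (hi : i < n) := by
    obtain ⟨h, -, hh⟩ := hc ⟨i, hi⟩
    exact ⟨h, h.2, (ofFamilies_in P S ⟨i, hi⟩ h).2 hh⟩

theorem covers_iff {n m : ℕ} (P : Fin n → ℝ × ℝ) (S : Fin m → WeightedHalfPlane)
    (T : Finset (Fin m)) : Covers P S T ↔
      CoversIndices n (IndexedInput.ofFamilies P S).In (T.map Fin.valEmbedding) := by
  constructor
  · intro h i hi
    obtain ⟨k, hk, hc⟩ := h ⟨i, hi⟩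
    exact ⟨k, Finset.mem_map_of_mem _ hk, (ofFamilies_in P S ⟨i, hi⟩ k).2 hc⟩
  · intro h i
    obtain ⟨k, hk, hc⟩ := h i i.2
    obtain ⟨k, hk', rfl⟩ := Finset.mem_map.1 hk
    exact ⟨k, hk', (ofFamilies_in P S i k).1 hc⟩

theorem totalWeight_eq {n m : ℕ} (P : Fin n → ℝ × ℝ) (S : Fin m → WeightedHalfPlane)
    (T : Finset (Fin m)) : totalWeight S T =
      ∑ h ∈ T.map Fin.valEmbedding, (IndexedInput.ofFamilies P S).w h := by
  rw [totalWeight, Finset.sum_map]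
  exact Finset.sum_congr rfl fun h _ => (ofFamilies_w P S h).symm

theorem map_outputSet (m : ℕ) (s : Mem) :
    (outputSet m s).map Fin.valEmbedding = marked m s := by
  ext h
  simp only [outputSet, marked, Finset.mem_map, Finset.mem_filter, Finset.mem_univ, true_and,
    Finset.mem_range, Fin.valEmbedding_apply]
  constructor
  · rintro ⟨k, hk, rfl⟩
    exact ⟨k.2, hk⟩
  · rintro ⟨hh, h1⟩
    exact ⟨⟨h, hh⟩, h1, rfl⟩

theorem coverageProg_correct {n m : ℕ} (P : Fin n → ℝ × ℝ) (S : Fin m → WeightedHalfPlane)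
    (hc : Covers P S Finset.univ) (mode : Bool) :
    ∃ (t : ℕ) (s : Mem), Exec ((n + m + 2) ^ 1) (coverageProg mode) (inputMem P S) t s ∧
      t ≤ 4000 * n ^ 3 + 4000 * ((if mode then n else m) * (n ^ 2 * m)) + 7 ∧
      IsMinWeightCoverage P S (outputSet m s) := by
  obtain ⟨t, s, he, ht, h1, h2⟩ := runs_coverageProg (W := (n + m + 2) ^ 1) mode
    (ofFamilies_valid hc) (hasInput_inputMem P S) (by rw [pow_one]; exact le_rfl) rfl fun _ => rfl
  refine ⟨t, s, he, ?_, ?_, fun T' hT' => ?_⟩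
  · cases mode <;> exact ht
  · rw [covers_iff, map_outputSet]
    exact h1
  · rw [totalWeight_eq P, totalWeight_eq P, map_outputSet]
    refine h2 _ (fun h hh => ?_) ((covers_iff P S T').1 hT')
    obtain ⟨k, -, rfl⟩ := Finset.mem_map.1 hh
    exact Finset.mem_range.2 k.2

/-! ### Absorbing the operation counts into the logarithmic bounds. -/

theorem Covers.m_pos {n m : ℕ} {P : Fin n → ℝ × ℝ} {S : Fin m → WeightedHalfPlane}
    {T : Finset (Fin m)} (hc : Covers P S T) (hn : 0 < n) : 0 < m := by
  obtain ⟨h, -⟩ := hc ⟨0, hn⟩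
  exact h.pos

theorem half_le_log {x : ℝ} (hx : 2 ≤ x) : 1 / 2 ≤ Real.log x := by
  have h1 := Real.log_two_gt_d9
  have h2 := Real.log_le_log (by norm_num) hx
  linarith

/-- The summand 1 pays for `n = 1`, where the logarithm vanishes. -/
theorem cube_le (n : ℕ) : (n : ℝ) ^ 3 ≤ 2 * ((n : ℝ) ^ 3 * Real.log n) + 1 := by
  rcases Nat.lt_or_ge n 2 with hn | hn
  · interval_cases n <;> norm_num
  · have h1 := half_le_log (x := n) (by exact_mod_cast hn)
    have h2 : (0 : ℝ) ≤ (n : ℝ) ^ 3 := by positivity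
    nlinarith

/-- For `m = 1` the logarithm vanishes, and the left side, then `n ^ 2`, is charged to `n ^ 3`. -/
theorem sq_mul_sq_le (n m : ℕ) : (n : ℝ) ^ 2 * (m : ℝ) ^ 2 ≤
    2 * ((n : ℝ) ^ 2 * (m : ℝ) ^ 2 * Real.log m) + (n : ℝ) ^ 3 := by
  have hn3 : (n : ℝ) ^ 2 ≤ (n : ℝ) ^ 3 := by
    exact_mod_cast (show n ^ 2 ≤ n ^ 3 by
      rcases Nat.eq_zero_or_pos n with rfl | hn
      · norm_num
      · exact Nat.pow_le_pow_right hn (by norm_num))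
  rcases Nat.lt_or_ge m 2 with hm | hm
  · interval_cases m
    · norm_num
    · norm_num
      exact hn3
  · have h1 := half_le_log (x := m) (by exact_mod_cast hm)
    have h2 : (0 : ℝ) ≤ (n : ℝ) ^ 2 * (m : ℝ) ^ 2 := by positivity
    have h3 : (0 : ℝ) ≤ (n : ℝ) ^ 3 := by positivity
    nlinarith

end HalfPlaneCoverage

theorem mainTheorem2 :
    HalfPlaneCoverage.SolvableInTime
      (fun n m => (n : ℝ) ^ 3 * (m : ℝ) * Real.log ((m : ℝ) + (n : ℝ)) + 1) ∧
    HalfPlaneCoverage.SolvableInTime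
      (fun n m => (n : ℝ) ^ 3 * Real.log (n : ℝ) +
        (n : ℝ) ^ 2 * (m : ℝ) ^ 2 * Real.log (m : ℝ) + 1) := by
  constructor
  · refine ⟨HalfPlaneCoverage.coverageProg true, 1, 16000, fun n m P S hc => ?_⟩
    obtain ⟨t, s, he, ht, hmin⟩ := HalfPlaneCoverage.coverageProg_correct P S hc true
    refine ⟨t, s, he, ?_, hmin⟩
    have ht' : (t : ℝ) ≤ 4000 * (n : ℝ) ^ 3 + 4000 * ((n : ℝ) ^ 3 * m) + 7 := by
      have : t ≤ 4000 * n ^ 3 + 4000 * (n ^ 3 * m) + 7 := by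
        refine ht.trans (le_of_eq ?_)
        rw [if_pos rfl]
        ring
      exact_mod_cast this
    rcases Nat.eq_zero_or_pos n with rfl | hn
    · norm_num at ht' ⊢
      linarith
    · have hm : (1 : ℝ) ≤ m := by exact_mod_cast hc.m_pos hn
      have hn' : (1 : ℝ) ≤ n := by exact_mod_cast hn
      have hlog := HalfPlaneCoverage.half_le_log (x := (m : ℝ) + n) (by linarith)
      have h1 : (n : ℝ) ^ 3 ≤ (n : ℝ) ^ 3 * m := le_mul_of_one_le_right (by positivity) hm
      have h2 : (0 : ℝ) ≤ (n : ℝ) ^ 3 * m := by positivity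
      have h3 := mul_le_mul_of_nonneg_left hlog h2
      linarith
  · refine ⟨HalfPlaneCoverage.coverageProg false, 1, 30000, fun n m P S hc => ?_⟩
    obtain ⟨t, s, he, ht, hmin⟩ := HalfPlaneCoverage.coverageProg_correct P S hc false
    refine ⟨t, s, he, ?_, hmin⟩
    have ht' : (t : ℝ) ≤ 4000 * (n : ℝ) ^ 3 + 4000 * ((n : ℝ) ^ 2 * (m : ℝ) ^ 2) + 7 := by
      have : t ≤ 4000 * n ^ 3 + 4000 * (n ^ 2 * m ^ 2) + 7 := by
        refine ht.trans (le_of_eq ?_)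
        simp only [Bool.false_eq_true, if_false]
        ring
      exact_mod_cast this
    have h1 := HalfPlaneCoverage.cube_le n
    have h2 := HalfPlaneCoverage.sq_mul_sq_le n m
    have h3 : (0 : ℝ) ≤ (n : ℝ) ^ 3 * Real.log n := by positivity
    have h4 : (0 : ℝ) ≤ (n : ℝ) ^ 2 * (m : ℝ) ^ 2 * Real.log m := by positivity
    linarith
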